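/- \textbf{Setting.} Let $S$ be a measurable space with a $\sigma$-finite reference measure $ds$ (for example a measurable subset of $\mathbb R^n$ with Lebesgue measure), $A\subseteq\mathbb R^m$ (actions), $G\subseteq\mathbb R^q$ (goals) and $\Theta\subseteq\mathbb R^d$ (manager parameters) open sets, $\rho_0$ an initial probability density, $p(s'\mid s,a)$ a transition density, $\gamma\in(0,1]$, $k\ge 1$, $r_m:S\to\mathbb R$ the environmental reward, $r_w:S\times G\times A\to\mathbb R$ the intrinsic reward, $\pi_m=\pi_m(\theta_m,\cdot):S\to G$ for $\theta_m\in\Theta$ and $\pi_w:S\times G\to A$ the deterministic manager and worker policies, and $h:S\times G\times S\to G$ a fixed goal transition function. All functions are measurable; $r_m$, $r_w$ are bounded; $r_w$ is (jointly) differentiable in $(g,a)$, $\pi_m$ in $\theta_m$, $\pi_w$ in $g$, $h$ in $g$, all with bounded derivatives; $p(s'\mid s,a)$ is differentiable in $a$, $\nabla_a p(s'\mid s,a)$ is dominated, for $a$ near any given point, by an integrable function of $s'$, and $\sup_{s,a}\int\|\nabla_a p(s'\mid s,a)\|\,ds'<\infty$. Goals are assigned by $$g_t(\theta_m)=\begin{cases}\pi_m(s_t)&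 t \bmod k=0,\\ h(s_{t-1},g_{t-1}(\theta_m),s_t)&\text{otherwise,}\end{cases}$$ the worker acts by $a_t=\pi_w(s_t,g_t)$, and $(s_0,\dots,s_n)$ has the density $\rho_0(s_0)\prod_{j<n}p(s_{j+1}\mid s_j,\pi_w(s_j,g_j))$; $\mathbb E$ is the expectation for these laws. Let $N_m,N_w\in\mathbb N\cup\{\infty\}$ be horizons (both finite if $\gamma=1$), $\lambda\in\mathbb R$, and $$J_m=\sum_{t=0}^{N_m}\gamma^t\,\mathbb E[r_m(s_{kt})],\qquad J_w=\sum_{t=0}^{N_w}\gamma^t\,\mathbb E[r_w(s_t,g_t,\pi_w(s_t,g_t))],\qquad J_m'=J_m+\lambda J_w .$$ Let $Q_m^{N}(s,a)$ be the expected discounted environmental return $\sum_{n=0}^{N}\gamma^n\,\mathbb E[r_m(s_{kn})]$ when $s_0=s$, $g_0=a$ and all later goals are assigned as above. Let $V_{w,t}^{N}(s,g)=\sum_{n=0}^{N}\gamma^n\,\mathbb E[r_w(s_{t+n},g_{t+n},\pi_w(s_{t+n},g_{t+n}))\mid s_t=s,g_t=g]$ and $$Q_{w,t}^{N}(s,g,a)=r_w(s,g,a)+\gamma\int_S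 p(s'\mid s,a)\,V_{w,t+1}^{N-1}(s',g')\,ds',$$ where $g'=\pi_m(s')$ if $(t+1)\bmod k=0$ and $g'=h(s,g,s')$ otherwise; the integral term is absent if $N=0$. With $\infty-t=\infty$, write $Q_m=Q_m^{N_m-t}$ and $Q_w=Q_{w,t}^{N_w-t}$ in the $t$-th terms below. Gradients $\nabla_{\theta_m}\pi_m$, $\nabla_{\theta_m}g_t$ are transposed Jacobians, the latter for fixed states $s_0,\dots,s_t$. \textbf{Theorem.} For every $\theta_m\in\Theta$ the returns $J_m$, $J_w$ and all derivatives, expectations and series below are well defined (the expectations and series converge absolutely), $J_m'$ is differentiable at $\theta_m$, and $$\begin{aligned}\nabla_{\theta_m}J_m'={}&\sum_{t=0}^{N_m}\gamma^t\,\mathbb E\Big[\nabla_{\theta_m}\pi_m(s_{kt})\,\nabla_aQ_m(s_{kt},a)\big|_{a=\pi_m(s_{kt})}\Big]\\&+\lambda\sum_{t=0}^{N_w}\gamma^t\,\mathbb E\Big[\nabla_{\theta_m}g_t\,\nabla_g\Big(r_w(s_t,g,\pi_w(s_t,g_t))+\big\langle\pi_w(s_t,g),\nabla_aQ_w(s_t,g_t,a)\big|_{a=\pi_w(s_t,g_t)}\big\rangle\Big)\Big|_{g=g_t}\Big].\end{aligned}$$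 -/

import Mathlib

/-- A two-level goal-conditioned hierarchy acting in a Markov decision process.
States form a measurable space `S` with a reference measure `vol` (for instance a measurable
subset of `ℝⁿ` with Lebesgue measure); actions live in `A ⊆ ℝᵐ`, goals in `G ⊆ ℝ^q`, and the
manager's parameters in `ℝᵈ`. Functions are total; their values for actions outside `A` or goals
outside `G` are never used. -/
structure HRLModel (S : Type*) [MeasurableSpace S] (m q d : ℕ) where
  /-- reference measure on the state space (`ds`) -/
  vol : MeasureTheory.Measure S
  /-- action space -/
  A : Set (EuclideanSpace ℝ (Fin m))
  /-- goal space -/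
  G : Set (EuclideanSpace ℝ (Fin q))
  /-- transition density `p s a s' = p(s' | s, a)` -/
  p : S → EuclideanSpace ℝ (Fin m) → S → ℝ
  /-- initial state density -/
  ρ₀ : S → ℝ
  /-- discount factor -/
  γ : ℝ
  /-- length of a meta-period -/
  k : ℕ
  /-- environmental (manager) reward `r_m(s)` -/
  rewM : S → ℝ
  /-- intrinsic (worker) reward `r_w(s, g, a)` -/
  rewW : S → EuclideanSpace ℝ (Fin q) → EuclideanSpace ℝ (Fin m) → ℝ
  /-- deterministic manager policy: `polM θ s` is `π_m(s)` for the parameter `θ` -/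
  polM : EuclideanSpace ℝ (Fin d) → S → EuclideanSpace ℝ (Fin q)
  /-- deterministic worker policy `π_w(s, g)` -/
  polW : S → EuclideanSpace ℝ (Fin q) → EuclideanSpace ℝ (Fin m)
  /-- goal transition `h(s, g, s')` inside a meta-period -/
  h : S → EuclideanSpace ℝ (Fin q) → S → EuclideanSpace ℝ (Fin q)

namespace HRLModel

variable {S : Type*} [MeasurableSpace S] {m q d : ℕ}

/-- Standing assumptions: the data are a Markov decision process with policies taking values in
the action and goal spaces, everything is measurable, and the regularity conditions of
deterministic policy gradients hold for parameters in the open set `Θ`. -/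
structure Regular (M : HRLModel S m q d) (Θ : Set (EuclideanSpace ℝ (Fin d))) : Prop where
  sigmaFinite : MeasureTheory.SigmaFinite M.vol
  isOpen_A : IsOpen M.A
  isOpen_G : IsOpen M.G
  isOpen_param : IsOpen Θ
  k_pos : 0 < M.k
  γ_pos : 0 < M.γ
  γ_le_one : M.γ ≤ 1
  -- the policies and the goal transition respect the goal and action spaces
  polM_mem : ∀ θ ∈ Θ, ∀ s, M.polM θ s ∈ M.G
  polW_mem : ∀ s, ∀ g ∈ M.G, M.polW s g ∈ M.A
  h_mem : ∀ s, ∀ g ∈ M.G, ∀ s', M.h s g s' ∈ M.G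
  -- probability densities
  ρ₀_nonneg : ∀ s, 0 ≤ M.ρ₀ s
  ρ₀_integral : ∫ s, M.ρ₀ s ∂M.vol = 1
  p_nonneg : ∀ s, ∀ a ∈ M.A, ∀ s', 0 ≤ M.p s a s'
  p_integral : ∀ s, ∀ a ∈ M.A, ∫ s', M.p s a s' ∂M.vol = 1
  -- measurability
  ρ₀_meas : Measurable M.ρ₀
  p_meas : Measurable fun z : S × EuclideanSpace ℝ (Fin m) × S => M.p z.1 z.2.1 z.2.2
  rewM_meas : Measurable M.rewM
  rewW_meas : Measurable
    fun z : S × EuclideanSpace ℝ (Fin q) × EuclideanSpace ℝ (Fin m) => M.rewW z.1 z.2.1 z.2.2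
  polM_meas : ∀ θ ∈ Θ, Measurable (M.polM θ)
  polW_meas : Measurable fun z : S × EuclideanSpace ℝ (Fin q) => M.polW z.1 z.2
  h_meas : Measurable fun z : S × EuclideanSpace ℝ (Fin q) × S => M.h z.1 z.2.1 z.2.2
  -- bounded rewards
  rewM_bdd : ∃ R, ∀ s, |M.rewM s| ≤ R
  rewW_bdd : ∃ R, ∀ s, ∀ g ∈ M.G, ∀ a ∈ M.A, |M.rewW s g a| ≤ R
  -- differentiability with bounded derivatives
  rewW_diff : ∀ s, ∀ g ∈ M.G, ∀ a ∈ M.A, DifferentiableAt ℝ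
    (fun z : EuclideanSpace ℝ (Fin q) × EuclideanSpace ℝ (Fin m) => M.rewW s z.1 z.2) (g, a)
  rewW_fderiv_bdd : ∃ L, ∀ s, ∀ g ∈ M.G, ∀ a ∈ M.A, ‖fderiv ℝ
    (fun z : EuclideanSpace ℝ (Fin q) × EuclideanSpace ℝ (Fin m) => M.rewW s z.1 z.2) (g, a)‖ ≤ L
  polM_diff : ∀ θ ∈ Θ, ∀ s, DifferentiableAt ℝ (fun θ' => M.polM θ' s) θ
  polM_fderiv_bdd : ∃ L, ∀ θ ∈ Θ, ∀ s, ‖fderiv ℝ (fun θ' => M.polM θ' s) θ‖ ≤ L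
  polW_diff : ∀ s, ∀ g ∈ M.G, DifferentiableAt ℝ (M.polW s) g
  polW_fderiv_bdd : ∃ L, ∀ s, ∀ g ∈ M.G, ‖fderiv ℝ (M.polW s) g‖ ≤ L
  h_diff : ∀ s, ∀ g ∈ M.G, ∀ s', DifferentiableAt ℝ (fun g' => M.h s g' s') g
  h_fderiv_bdd : ∃ L, ∀ s, ∀ g ∈ M.G, ∀ s', ‖fderiv ℝ (fun g' => M.h s g' s') g‖ ≤ L
  -- the transition density is differentiable in the action; its gradient is locally dominated by
  -- an integrable function of the next state and uniformly bounded in `L¹`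
  p_diff : ∀ s, ∀ a ∈ M.A, ∀ s', DifferentiableAt ℝ (fun a' => M.p s a' s') a
  p_grad_dominated : ∀ s, ∀ a ∈ M.A, ∃ ε > 0, ∃ b : S → ℝ, MeasureTheory.Integrable b M.vol ∧
    ∀ a' ∈ Metric.ball a ε ∩ M.A, ∀ s', ‖gradient (fun a'' => M.p s a'' s') a'‖ ≤ b s'
  p_grad_L1_bdd : ∃ L, ∀ s, ∀ a ∈ M.A,
    ∫ s', ‖gradient (fun a' => M.p s a' s') a‖ ∂M.vol ≤ L

/-- The goal that follows the goal `g` of time `t`, when the state moves from `s` to `s'`. -/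
noncomputable def nextGoal (M : HRLModel S m q d) (θ : EuclideanSpace ℝ (Fin d)) (t : ℕ)
    (s : S) (g : EuclideanSpace ℝ (Fin q)) (s' : S) : EuclideanSpace ℝ (Fin q) :=
  if (t + 1) % M.k = 0 then M.polM θ s' else M.h s g s'

/-- The goals of times `t, t + 1, …`, when the goal of time `t` is `g` and the states of times
`t, t + 1, …` are `x 0, x 1, …`. -/
noncomputable def goalFrom (M : HRLModel S m q d) (θ : EuclideanSpace ℝ (Fin d)) (t : ℕ)
    (g : EuclideanSpace ℝ (Fin q)) (x : ℕ → S) : ℕ → EuclideanSpace ℝ (Fin q)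
  | 0 => g
  | j + 1 => M.nextGoal θ (t + j) (x j) (M.goalFrom θ t g x j) (x (j + 1))

/-- The goal `g_t(θ)` along the state trajectory `x`: it is `π_m(s_t)` if `t mod k = 0` and
`h(s_{t-1}, g_{t-1}(θ), s_t)` otherwise. -/
noncomputable def goal (M : HRLModel S m q d) (θ : EuclideanSpace ℝ (Fin d)) (x : ℕ → S)
    (t : ℕ) : EuclideanSpace ℝ (Fin q) :=
  M.goalFrom θ 0 (M.polM θ (x 0)) x t

/-- View a finite trajectory `(x_0, …, x_n)` as a sequence which is constant after time `n`. -/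
def extend {n : ℕ} (x : Fin (n + 1) → S) : ℕ → S :=
  fun j => x ⟨min j n, by omega⟩

/-- Probability density of the `n` transitions `x 0 → x 1 → … → x n`, started at time `t` with
goal `g`. -/
noncomputable def transDensity (M : HRLModel S m q d) (θ : EuclideanSpace ℝ (Fin d)) (t : ℕ)
    (g : EuclideanSpace ℝ (Fin q)) (x : ℕ → S) (n : ℕ) : ℝ :=
  ∏ j ∈ Finset.range n, M.p (x j) (M.polW (x j) (M.goalFrom θ t g x j)) (x (j + 1))

/-- Expectation of `F(s_t, …, s_{t+n})` given that the state and the goal of time `t` are `s` and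
`g`; the argument of `F` lists the states from time `t` on. -/
noncomputable def condExpect (M : HRLModel S m q d) (θ : EuclideanSpace ℝ (Fin d)) (t : ℕ)
    (s : S) (g : EuclideanSpace ℝ (Fin q)) (n : ℕ) (F : (ℕ → S) → ℝ) : ℝ :=
  ∫ y : Fin n → S,
    M.transDensity θ t g (extend (Fin.cons s y : Fin (n + 1) → S)) n *
      F (extend (Fin.cons s y : Fin (n + 1) → S)) ∂(MeasureTheory.Measure.pi fun _ => M.vol)

/-- Probability density of the trajectory `(s_0, …, s_n)` under the hierarchy. -/
noncomputable def trajDensity (M : HRLModel S m q d) (θ : EuclideanSpace ℝ (Fin d)) {n : ℕ}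
    (x : Fin (n + 1) → S) : ℝ :=
  M.ρ₀ (x 0) * M.transDensity θ 0 (M.polM θ (x 0)) (extend x) n

/-- `F(s_0, …, s_n)` is integrable under the law of the trajectory `(s_0, …, s_n)`. -/
def ExpectIntegrable {V : Type*} [NormedAddCommGroup V] [NormedSpace ℝ V]
    (M : HRLModel S m q d) (θ : EuclideanSpace ℝ (Fin d)) (n : ℕ) (F : (ℕ → S) → V) : Prop :=
  MeasureTheory.Integrable (fun x : Fin (n + 1) → S => M.trajDensity θ x • F (extend x))
    (MeasureTheory.Measure.pi fun _ => M.vol)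

/-- Expectation of `F(s_0, …, s_n)` under the law of the trajectory `(s_0, …, s_n)`. -/
noncomputable def expect {V : Type*} [NormedAddCommGroup V] [NormedSpace ℝ V]
    (M : HRLModel S m q d) (θ : EuclideanSpace ℝ (Fin d)) (n : ℕ) (F : (ℕ → S) → V) : V :=
  ∫ x : Fin (n + 1) → S, M.trajDensity θ x • F (extend x)
    ∂(MeasureTheory.Measure.pi fun _ => M.vol)

/-- The sequence `γ ^ t • u t` cut off after the horizon `N` (which may be infinite). -/
noncomputable def discounted {V : Type*} [AddCommGroup V] [Module ℝ V]
    (M : HRLModel S m q d) (N : ℕ∞) (u : ℕ → V) (t : ℕ) : V :=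
  open Classical in if (t : ℕ∞) ≤ N then M.γ ^ t • u t else 0

/-- `J_m = E[∑_{t = 0}^{N} γ ^ t r_m(s_{kt})]`. -/
noncomputable def Jm (M : HRLModel S m q d) (N : ℕ∞) (θ : EuclideanSpace ℝ (Fin d)) : ℝ :=
  ∑' t, M.discounted N (fun t => M.expect θ (M.k * t) fun x => M.rewM (x (M.k * t))) t

/-- The worker's reward at time `t` along the state trajectory `x`. -/
noncomputable def workerReward (M : HRLModel S m q d) (θ : EuclideanSpace ℝ (Fin d)) (t : ℕ)
    (x : ℕ → S) : ℝ :=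
  M.rewW (x t) (M.goal θ x t) (M.polW (x t) (M.goal θ x t))

/-- `J_w = E[∑_{t = 0}^{N} γ ^ t r_w(s_t, g_t, π_w(s_t, g_t))]`. -/
noncomputable def Jw (M : HRLModel S m q d) (N : ℕ∞) (θ : EuclideanSpace ℝ (Fin d)) : ℝ :=
  ∑' t, M.discounted N (fun t => M.expect θ t (M.workerReward θ t)) t

/-- The manager's action value `Q_m(s, a)` with `N` further manager decisions to come: the
expected environmental return from the state `s` at the start of a meta-period, when the goal `a`
is assigned there and `π_m` assigns all later goals. -/
noncomputable def Qm (M : HRLModel S m q d) (θ : EuclideanSpace ℝ (Fin d)) (N : ℕ∞)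
    (s : S) (a : EuclideanSpace ℝ (Fin q)) : ℝ :=
  ∑' n, M.discounted N
    (fun n => M.condExpect θ 0 s a (M.k * n) fun x => M.rewM (x (M.k * n))) n

/-- The worker's value `V_w(s, g)` at time `t` with `N` further steps to come: the expected
intrinsic return from the state `s` and the goal `g` at time `t`. -/
noncomputable def Vw (M : HRLModel S m q d) (θ : EuclideanSpace ℝ (Fin d)) (N : ℕ∞) (t : ℕ)
    (s : S) (g : EuclideanSpace ℝ (Fin q)) : ℝ :=
  ∑' n, M.discounted N
    (fun n => M.condExpect θ t s g n fun x =>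
      M.rewW (x n) (M.goalFrom θ t g x n) (M.polW (x n) (M.goalFrom θ t g x n))) n

/-- The worker's action value `Q_w(s, g, a)` at time `t` with `N` further steps to come. -/
noncomputable def Qw (M : HRLModel S m q d) (θ : EuclideanSpace ℝ (Fin d)) (N : ℕ∞) (t : ℕ)
    (s : S) (g : EuclideanSpace ℝ (Fin q)) (a : EuclideanSpace ℝ (Fin m)) : ℝ :=
  M.rewW s g a +
    open Classical in
    if N = 0 then 0
    else M.γ * ∫ s', M.p s a s' * M.Vw θ (N - 1) (t + 1) s' (M.nextGoal θ t s g s') ∂M.vol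

/-- `∇_θ π_m(s) ∇_a Q_m(s, a)|_{a = π_m(s)}`, where `∇_θ π_m(s)` is the transposed Jacobian. -/
noncomputable def managerGrad (M : HRLModel S m q d) (θ : EuclideanSpace ℝ (Fin d)) (N : ℕ∞)
    (s : S) : EuclideanSpace ℝ (Fin d) :=
  ContinuousLinearMap.adjoint (fderiv ℝ (fun θ' => M.polM θ' s) θ)
    (gradient (fun a => M.Qm θ N s a) (M.polM θ s))

/-- `∇_g (r_w(s_t, g, π_w(s_t, g_t)) + π_w(s_t, g) ∇_a Q_w(s_t, g_t, a)|_{a = π_w(s_t, g_t)})`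
at `g = g_t`, for the state `s = s_t` and the goal `gt = g_t`. -/
noncomputable def goalGrad (M : HRLModel S m q d) (θ : EuclideanSpace ℝ (Fin d)) (N : ℕ∞)
    (t : ℕ) (s : S) (gt : EuclideanSpace ℝ (Fin q)) : EuclideanSpace ℝ (Fin q) :=
  gradient
    (fun g => M.rewW s g (M.polW s gt) +
      inner ℝ (M.polW s g) (gradient (fun a => M.Qw θ N t s gt a) (M.polW s gt))) gt

/-- `∇_θ g_t` (the transposed Jacobian) applied to `goalGrad`, along the state trajectory `x`. -/
noncomputable def workerGrad (M : HRLModel S m q d) (θ : EuclideanSpace ℝ (Fin d)) (N : ℕ∞)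
    (t : ℕ) (x : ℕ → S) : EuclideanSpace ℝ (Fin d) :=
  ContinuousLinearMap.adjoint (fderiv ℝ (fun θ' => M.goal θ' x t) θ)
    (M.goalGrad θ N t (x t) (M.goal θ x t))

end HRLModel

/-! The expected reward at one time is an iterated integral. Let v_n(θ, t, s, g) be the expectation
of f(s_{t+n}, g_{t+n}) given s_t = s and g_t = g; then v_{n+1}(θ, t, s, g) is the integral of p(s' |
s, π_w(s, g)) v_n(θ, t + 1, s', g'), where the next goal g' depends on θ and g. By induction on n,
dominated differentiation makes v_n jointly differentiable in (θ, g) (`hasFDerivAt_value`). The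
derivative obeys a linear recursion: an immediate effect of the goal, through the action chosen now
or through the final reward, plus the average of the next derivative composed with the derivative of
the next goal.

Unrolling this recursion (`AuxChain.IsMarkov.eq_sum_val`) writes the gradient of each expected
reward as a sum over the earlier times j at which the effect arises. There are two ways to unroll.
For the worker, the chain is enlarged by the Jacobian of the goal, so that the transported
derivative is again an expectation along a chain. This gives the sum of E[immediate effect at time j
∘ ∇g_j] (`dexpect_eq_sum_immediate`). For the manager, the reward ignores the goal and only the
partial derivative in θ is transported. It gains a contribution exactly when the manager chooses a
goal, so only the multiples of k survive (`dexpect_eq_sum_manager`).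

The discounted sum over n of the sums over j ≤ n is then rearranged along antidiagonals
(`tsum_discounted_antidiagonal`). For a fixed cause j, the inner series over the delay n - j is the
derivative of Q_m in the goal (`managerGrad_eq`), respectively the bracketed goal gradient built
from r_w and Q_w (`goalGrad_eq`).

Convergence rests on one estimate. A naive chain rule bounds the goal Jacobian at time t by a power
of L growing with t, which discounting need not beat. The manager however resets the goal every k
steps, so the Jacobian is bounded by L ^ (1 + t % k) ≤ L ^ k. Each step of the recursion therefore
adds a bounded amount, the derivative of v_n grows at most linearly in n (`dvalue_bounds`), and such
growth is summable against γ ^ n when γ < 1; if the horizon is finite there is nothing to sum. -/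

section

open MeasureTheory Filter Topology

/-! ### Markov chains with an auxiliary variable -/

/-- A controlled Markov chain with an auxiliary variable in `Z`: at time `t`, the state `s` moves to
`s'` with density `dens s z s'`, and the auxiliary variable then moves from `z` to `next t s z s'`.
The set `dom t` collects the values of the auxiliary variable that are admissible at time `t`. -/
structure AuxChain (S Z : Type*) [MeasurableSpace S] where
  /-- reference measure on the states -/
  vol : Measure S
  /-- transition density -/
  dens : S → Z → S → ℝ
  /-- motion of the auxiliary variable -/
  next : ℕ → S → Z → S → Z
  /-- admissible auxiliary variables -/
  dom : ℕ → Set Z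

namespace AuxChain

variable {S Z V : Type*} [MeasurableSpace S] [NormedAddCommGroup V] [NormedSpace ℝ V]

/-- The auxiliary variables along the states `x 0, x 1, …` of the times `t, t + 1, …`. -/
def path (C : AuxChain S Z) (t : ℕ) (z : Z) (x : ℕ → S) : ℕ → Z
  | 0 => z
  | j + 1 => C.next (t + j) (x j) (C.path t z x j) (x (j + 1))

/-- The density of the first `n` transitions. -/
def pathDens (C : AuxChain S Z) (t : ℕ) (z : Z) (x : ℕ → S) (n : ℕ) : ℝ :=
  ∏ j ∈ Finset.range n, C.dens (x j) (C.path t z x j) (x (j + 1))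

/-- The expectation of `F s_{t+n} z_{t+n}` given `s_t = s` and `z_t = z`, as an iterated integral. -/
noncomputable def val (C : AuxChain S Z) (F : S → Z → V) : ℕ → ℕ → S → Z → V
  | 0, _, s, z => F s z
  | n + 1, t, s, z => ∫ s', C.dens s z s' • C.val F n (t + 1) s' (C.next t s z s') ∂C.vol

variable {C : AuxChain S Z}

/-- `path` grows at its last state, while `val` recurses on the first transition; peeling off the
first state reconciles the two. -/
theorem path_succ' (t : ℕ) (z : Z) (x : ℕ → S) (j : ℕ) :
    C.path t z x (j + 1) =
      C.path (t + 1) (C.next t (x 0) z (x 1)) (fun i => x (i + 1)) j := by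
  induction j with
  | zero => rfl
  | succ j ih =>
    rw [path, ih, path]
    congr 1
    omega

theorem pathDens_succ' (t : ℕ) (z : Z) (x : ℕ → S) (n : ℕ) :
    C.pathDens t z x (n + 1) = C.dens (x 0) z (x 1) *
      C.pathDens (t + 1) (C.next t (x 0) z (x 1)) (fun i => x (i + 1)) n := by
  rw [pathDens, Finset.prod_range_succ', mul_comm, pathDens]
  congr 1
  exact Finset.prod_congr rfl fun j _ => by rw [path_succ']

variable [MeasurableSpace Z]

/-- The data of the chain are measurable, and they define probability densities and admissible
motions on the admissible values. -/
structure IsMarkov (C : AuxChain S Z) : Prop where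
  sigmaFinite : SigmaFinite C.vol
  dens_meas : Measurable fun w : S × Z × S => C.dens w.1 w.2.1 w.2.2
  next_meas : ∀ t, Measurable fun w : S × Z × S => C.next t w.1 w.2.1 w.2.2
  dens_nonneg : ∀ t s, ∀ z ∈ C.dom t, ∀ s', 0 ≤ C.dens s z s'
  dens_integral : ∀ t s, ∀ z ∈ C.dom t, ∫ s', C.dens s z s' ∂C.vol = 1
  next_mem : ∀ t s, ∀ z ∈ C.dom t, ∀ s', C.next t s z s' ∈ C.dom (t + 1)

namespace IsMarkov

theorem measurable_path (hC : C.IsMarkov) (t : ℕ) {X : Type*} [MeasurableSpace X] {z : X → Z}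
    {x : X → ℕ → S} (hz : Measurable z) (hx : Measurable x) (j : ℕ) :
    Measurable fun w => C.path t (z w) (x w) j := by
  have hx' := measurable_pi_iff.1 hx
  induction j with
  | zero => exact hz
  | succ j ih => exact (hC.next_meas (t + j)).comp ((hx' j).prodMk (ih.prodMk (hx' (j + 1))))

theorem measurable_pathDens (hC : C.IsMarkov) (t : ℕ) {X : Type*} [MeasurableSpace X] {z : X → Z}
    {x : X → ℕ → S} (hz : Measurable z) (hx : Measurable x) (n : ℕ) :
    Measurable fun w => C.pathDens t (z w) (x w) n := by
  have hx' := measurable_pi_iff.1 hx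
  unfold pathDens
  exact Finset.measurable_prod _ fun j _ =>
    hC.dens_meas.comp ((hx' j).prodMk ((hC.measurable_path t hz hx j).prodMk (hx' (j + 1))))

theorem path_mem (hC : C.IsMarkov) {t : ℕ} {z : Z} (hz : z ∈ C.dom t) (x : ℕ → S) (j : ℕ) :
    C.path t z x j ∈ C.dom (t + j) := by
  induction j with
  | zero => exact hz
  | succ j ih => exact hC.next_mem _ _ _ ih _

theorem pathDens_nonneg (hC : C.IsMarkov) {t : ℕ} {z : Z} (hz : z ∈ C.dom t) (x : ℕ → S) (n : ℕ) :
    0 ≤ C.pathDens t z x n :=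
  Finset.prod_nonneg fun j _ => hC.dens_nonneg _ _ _ (hC.path_mem hz x j) _

theorem integrable_dens (hC : C.IsMarkov) {t : ℕ} {z : Z} (hz : z ∈ C.dom t) (s : S) :
    Integrable (C.dens s z) C.vol := by
  -- A non-integrable function has Bochner integral 0, which contradicts total mass 1.
  by_contra h
  simpa [integral_undef h] using hC.dens_integral t s z hz

theorem integrable_dens_smul (hC : C.IsMarkov) {t : ℕ} {z : Z} (hz : z ∈ C.dom t) (s : S)
    {F : S → V} (hF : AEStronglyMeasurable F C.vol) {R : ℝ} (hR : ∀ s', ‖F s'‖ ≤ R) :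
    Integrable (fun s' => C.dens s z s' • F s') C.vol :=
  (hC.integrable_dens hz s).smul_bdd R hF (ae_of_all _ hR)

theorem norm_integral_dens_smul_le (hC : C.IsMarkov) {t : ℕ} {z : Z} (hz : z ∈ C.dom t) (s : S)
    {F : S → V} {R : ℝ} (hR : ∀ s', ‖F s'‖ ≤ R) :
    ‖∫ s', C.dens s z s' • F s' ∂C.vol‖ ≤ R := by
  refine (norm_integral_le_of_norm_le ((hC.integrable_dens hz s).mul_const R)
    (ae_of_all _ fun s' => ?_)).trans_eq ?_
  · rw [norm_smul, Real.norm_of_nonneg (hC.dens_nonneg t s z hz s')]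
    exact mul_le_mul_of_nonneg_left (hR s') (hC.dens_nonneg t s z hz s')
  · rw [integral_mul_const, hC.dens_integral t s z hz, one_mul]

theorem norm_val_le (hC : C.IsMarkov) {F : S → Z → V} {R : ℝ} {n : ℕ} : ∀ {t : ℕ}
    (_ : ∀ s, ∀ z ∈ C.dom (t + n), ‖F s z‖ ≤ R) (s : S) {z : Z} (_ : z ∈ C.dom t),
    ‖C.val F n t s z‖ ≤ R := by
  induction n with
  | zero => exact fun hR s z hz => hR s z hz
  | succ n ih =>
    intro t hR s z hz
    refine hC.norm_integral_dens_smul_le hz s fun s' => ih ?_ s' (hC.next_mem t s z hz s')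
    rwa [show t + 1 + n = t + (n + 1) by omega]

theorem stronglyMeasurable_val (hC : C.IsMarkov) {F : S → Z → V}
    (hF : StronglyMeasurable fun w : S × Z => F w.1 w.2) (n : ℕ) : ∀ t,
    StronglyMeasurable fun w : S × Z => C.val F n t w.1 w.2 := by
  have := hC.sigmaFinite
  induction n with
  | zero => exact fun _ => hF
  | succ n ih =>
    intro t
    simp only [val]
    refine StronglyMeasurable.integral_prod_right (f := fun (w : S × Z) (s' : S) =>
      C.dens w.1 w.2 s' • C.val F n (t + 1) s' (C.next t w.1 w.2 s')) ?_
    have h1 : Measurable fun p : (S × Z) × S => (p.1.1, p.1.2, p.2) := by fun_prop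
    refine StronglyMeasurable.smul (hC.dens_meas.comp h1).stronglyMeasurable ?_
    exact (ih (t + 1)).comp_measurable (measurable_snd.prodMk ((hC.next_meas t).comp h1))

end IsMarkov

end AuxChain

/-! ### Splitting off the first state of a finite trajectory -/

section FiniteTrajectory

variable {S V : Type*} [MeasurableSpace S] [NormedAddCommGroup V] [NormedSpace ℝ V]

theorem measurePreserving_fin_cons (μ : Measure S) [SigmaFinite μ] (n : ℕ) :
    MeasurePreserving (MeasurableEquiv.piFinSuccAbove (fun _ : Fin (n + 1) => S) 0).symm
      (μ.prod (Measure.pi fun _ : Fin n => μ)) (Measure.pi fun _ : Fin (n + 1) => μ) :=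
  (measurePreserving_piFinSuccAbove (fun _ => μ) 0).symm _

theorem piFinSuccAbove_zero_symm_apply {n : ℕ} (w : S × (Fin n → S)) :
    (MeasurableEquiv.piFinSuccAbove (fun _ : Fin (n + 1) => S) 0).symm w =
      (Fin.cons w.1 w.2 : Fin (n + 1) → S) :=
  Fin.insertNth_zero' w.1 w.2

theorem integral_fin_cons (μ : Measure S) [SigmaFinite μ] {n : ℕ} (f : (Fin (n + 1) → S) → V) :
    ∫ x, f x ∂(Measure.pi fun _ => μ) =
      ∫ w : S × (Fin n → S), f (Fin.cons w.1 w.2) ∂(μ.prod (Measure.pi fun _ => μ)) := by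
  rw [← (measurePreserving_fin_cons μ n).integral_comp']
  simp only [piFinSuccAbove_zero_symm_apply]

omit [NormedSpace ℝ V] in
theorem integrable_fin_cons_iff (μ : Measure S) [SigmaFinite μ] {n : ℕ}
    {f : (Fin (n + 1) → S) → V} :
    Integrable f (Measure.pi fun _ => μ) ↔
      Integrable (fun w : S × (Fin n → S) => f (Fin.cons w.1 w.2))
        (μ.prod (Measure.pi fun _ => μ)) := by
  rw [← (measurePreserving_fin_cons μ n).integrable_comp_emb (MeasurableEquiv.measurableEmbedding _)]
  simp only [Function.comp_def, piFinSuccAbove_zero_symm_apply]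

namespace HRLModel

omit [MeasurableSpace S] in
theorem extend_cons_zero {n : ℕ} (s : S) (y : Fin n → S) :
    extend (Fin.cons s y : Fin (n + 1) → S) 0 = s := by
  simp [extend]

omit [MeasurableSpace S] in
theorem extend_cons_succ {n : ℕ} (s : S) (y : Fin (n + 1) → S) (j : ℕ) :
    extend (Fin.cons s y : Fin (n + 1 + 1) → S) (j + 1) = extend y j := by
  have : (⟨min (j + 1) (n + 1), by omega⟩ : Fin (n + 1 + 1)) =
      Fin.succ ⟨min j n, by omega⟩ := by
    ext; simp
  rw [extend, this, Fin.cons_succ, extend]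

theorem measurable_extend {n : ℕ} : Measurable (extend : (Fin (n + 1) → S) → ℕ → S) :=
  measurable_pi_iff.2 fun _ => measurable_pi_apply _

theorem measurable_fin_cons {n : ℕ} :
    Measurable fun w : S × (Fin n → S) => (Fin.cons w.1 w.2 : Fin (n + 1) → S) := by
  simp only [← piFinSuccAbove_zero_symm_apply]
  exact MeasurableEquiv.measurable _

end HRLModel

end FiniteTrajectory

/-! ### Integrals over trajectories as iterated integrals -/

namespace AuxChain.IsMarkov

variable {S Z V : Type*} [MeasurableSpace S] [MeasurableSpace Z]
  [NormedAddCommGroup V] [NormedSpace ℝ V] {C : AuxChain S Z}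

open HRLModel

theorem measurable_extend_cons {n : ℕ} (s : S) :
    Measurable fun y : Fin n → S => extend (Fin.cons s y : Fin (n + 1) → S) :=
  measurable_extend.comp (measurable_fin_cons.comp measurable_prodMk_left)

theorem measurable_extend_cons_pair {n : ℕ} :
    Measurable fun w : S × (Fin n → S) => extend (Fin.cons w.1 w.2 : Fin (n + 1) → S) :=
  measurable_extend.comp measurable_fin_cons

omit [MeasurableSpace Z] in
theorem pathDens_extend_cons (C : AuxChain S Z) {n : ℕ} (t : ℕ) (s s' : S) (z : Z)
    (y : Fin n → S) :
    C.pathDens t z (extend (Fin.cons s (Fin.cons s' y : Fin (n + 1) → S) : Fin (n + 1 + 1) → S))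
      (n + 1) = C.dens s z s' *
        C.pathDens (t + 1) (C.next t s z s') (extend (Fin.cons s' y : Fin (n + 1) → S)) n := by
  rw [pathDens_succ', extend_cons_zero, extend_cons_succ, extend_cons_zero]
  simp only [extend_cons_succ]

omit [MeasurableSpace Z] in
theorem path_extend_cons (C : AuxChain S Z) {n : ℕ} (t : ℕ) (s s' : S) (z : Z) (y : Fin n → S)
    (j : ℕ) :
    C.path t z (extend (Fin.cons s (Fin.cons s' y : Fin (n + 1) → S) : Fin (n + 1 + 1) → S))
      (j + 1) =
        C.path (t + 1) (C.next t s z s') (extend (Fin.cons s' y : Fin (n + 1) → S)) j := by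
  rw [path_succ', extend_cons_zero, extend_cons_succ, extend_cons_zero]
  simp only [extend_cons_succ]

/-- Tonelli, one transition at a time: once the first transition is fixed, the remaining densities
have mass one by induction, which leaves the one-step density. Integrability and total mass are
proved together because integrability on the product needs the value of the inner integral. -/
theorem integrable_pathDens (hC : C.IsMarkov) (n : ℕ) : ∀ (t : ℕ) (s : S), ∀ z ∈ C.dom t,
    Integrable (fun y : Fin n → S => C.pathDens t z (extend (Fin.cons s y : Fin (n + 1) → S)) n)
        (Measure.pi fun _ => C.vol) ∧
      ∫ y : Fin n → S, C.pathDens t z (extend (Fin.cons s y : Fin (n + 1) → S)) n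
        ∂(Measure.pi fun _ => C.vol) = 1 := by
  have := hC.sigmaFinite
  induction n with
  | zero =>
    intro t s z _
    rw [Measure.pi_of_empty (fun _ : Fin 0 => C.vol)]
    exact ⟨integrable_dirac (by finiteness), by rw [integral_dirac]; simp [pathDens]⟩
  | succ n ih =>
    intro t s z hz
    have hint : Integrable (fun w : S × (Fin n → S) => C.dens s z w.1 *
        C.pathDens (t + 1) (C.next t s z w.1) (extend (Fin.cons w.1 w.2 : Fin (n + 1) → S)) n)
        (C.vol.prod (Measure.pi fun _ => C.vol)) := by
      rw [integrable_prod_iff]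
      · refine ⟨ae_of_all _ fun s' =>
          Integrable.const_mul (ih (t + 1) s' _ (hC.next_mem t s z hz s')).1 (C.dens s z s'),
          (hC.integrable_dens hz s).congr (ae_of_all _ fun s' => ?_)⟩
        have h0 : ∀ y : Fin n → S, ‖C.dens s z s' * C.pathDens (t + 1) (C.next t s z s')
            (extend (Fin.cons s' y : Fin (n + 1) → S)) n‖ = C.dens s z s' *
            C.pathDens (t + 1) (C.next t s z s') (extend (Fin.cons s' y : Fin (n + 1) → S)) n :=
          fun y => Real.norm_of_nonneg (mul_nonneg (hC.dens_nonneg t s z hz s')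
            (hC.pathDens_nonneg (hC.next_mem t s z hz s') _ _))
        simp only [h0]
        rw [integral_const_mul, (ih (t + 1) s' _ (hC.next_mem t s z hz s')).2, mul_one]
      · refine (Measurable.mul (hC.dens_meas.comp (by fun_prop :
          Measurable fun w : S × (Fin n → S) => (s, z, w.1)))
          (hC.measurable_pathDens (t + 1) ((hC.next_meas t).comp (by fun_prop :
          Measurable fun w : S × (Fin n → S) => (s, z, w.1)))
          measurable_extend_cons_pair n)).aestronglyMeasurable
    constructor
    · rw [integrable_fin_cons_iff]
      simpa only [pathDens_extend_cons] using hint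
    · rw [integral_fin_cons]
      simp only [pathDens_extend_cons]
      rw [integral_prod _ hint]
      simp only [integral_const_mul]
      rw [← hC.dens_integral t s z hz]
      exact integral_congr_ae (ae_of_all _ fun s' => by
        simp only [(ih (t + 1) s' _ (hC.next_mem t s z hz s')).2, mul_one])

theorem integrable_pathDens_smul (hC : C.IsMarkov) {n t : ℕ} (s : S) {z : Z} (hz : z ∈ C.dom t)
    {F : S → Z → V} (hF : StronglyMeasurable fun w : S × Z => F w.1 w.2) {R : ℝ}
    (hR : ∀ s, ∀ z ∈ C.dom (t + n), ‖F s z‖ ≤ R) :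
    Integrable (fun y : Fin n → S =>
      C.pathDens t z (extend (Fin.cons s y : Fin (n + 1) → S)) n •
        F (extend (Fin.cons s y : Fin (n + 1) → S) n)
          (C.path t z (extend (Fin.cons s y : Fin (n + 1) → S)) n))
      (Measure.pi fun _ => C.vol) := by
  refine (hC.integrable_pathDens n t s z hz).1.smul_bdd R ?_
    (ae_of_all _ fun y => hR _ _ (hC.path_mem hz _ n))
  exact (hF.comp_measurable (((measurable_pi_apply n).comp (measurable_extend_cons s)).prodMk
    (hC.measurable_path t measurable_const (measurable_extend_cons s) n))).aestronglyMeasurable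

/-- Fubini in the first transition turns the integral over all trajectories into the recursion that
defines `val`; boundedness of `F` on the admissible set supplies integrability. -/
theorem integral_pathDens_smul [CompleteSpace V] (hC : C.IsMarkov) {F : S → Z → V}
    (hF : StronglyMeasurable fun w : S × Z => F w.1 w.2) {R : ℝ} (n : ℕ) : ∀ {t : ℕ}
    (_ : ∀ s, ∀ z ∈ C.dom (t + n), ‖F s z‖ ≤ R) (s : S) {z : Z} (_ : z ∈ C.dom t),
    ∫ y : Fin n → S, C.pathDens t z (extend (Fin.cons s y : Fin (n + 1) → S)) n •
        F (extend (Fin.cons s y : Fin (n + 1) → S) n)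
          (C.path t z (extend (Fin.cons s y : Fin (n + 1) → S)) n)
      ∂(Measure.pi fun _ => C.vol) = C.val F n t s z := by
  have := hC.sigmaFinite
  induction n with
  | zero =>
    intro t hR s z _
    rw [Measure.pi_of_empty (fun _ : Fin 0 => C.vol), integral_dirac]
    simp [pathDens, val, path, extend_cons_zero]
  | succ n ih =>
    intro t hR s z hz
    have hint := hC.integrable_pathDens_smul s hz hF hR
    rw [integrable_fin_cons_iff] at hint
    rw [integral_fin_cons]
    simp only [pathDens_extend_cons, path_extend_cons, extend_cons_succ] at hint ⊢
    rw [integral_prod _ hint, val]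
    refine integral_congr_ae (ae_of_all _ fun s' => ?_)
    simp only [mul_smul]
    rw [integral_smul, ih (by rwa [show t + 1 + n = t + (n + 1) by omega]) s'
      (hC.next_mem t s z hz s')]

/-- A random initial state with density `ρ`. -/
theorem integrable_trajectory (hC : C.IsMarkov) {ρ : S → ℝ} (hρ : Integrable ρ C.vol)
    {z : S → Z} (hz : Measurable z) (hz0 : ∀ s, z s ∈ C.dom 0)
    {F : S → Z → V} (hF : StronglyMeasurable fun w : S × Z => F w.1 w.2) {R : ℝ} {n : ℕ}
    (hR : ∀ s, ∀ z ∈ C.dom n, ‖F s z‖ ≤ R) :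
    Integrable (fun x : Fin (n + 1) → S =>
      (ρ (x 0) * C.pathDens 0 (z (x 0)) (extend x) n) •
        F (extend x n) (C.path 0 (z (x 0)) (extend x) n)) (Measure.pi fun _ => C.vol) := by
  have := hC.sigmaFinite
  have hzx : Measurable fun w : S × (Fin n → S) => z w.1 := hz.comp measurable_fst
  refine Integrable.smul_bdd ?_ R ?_
    (ae_of_all _ fun x => hR _ _ (by simpa using hC.path_mem (hz0 (x 0)) (extend x) n))
  · rw [integrable_fin_cons_iff, integrable_prod_iff]
    · simp only [Fin.cons_zero]
      refine ⟨ae_of_all _ fun s => (hC.integrable_pathDens n 0 s _ (hz0 s)).1.const_mul _,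
        hρ.norm.congr (ae_of_all _ fun s => ?_)⟩
      simp only [norm_mul]
      rw [integral_const_mul]
      simp only [Real.norm_of_nonneg (hC.pathDens_nonneg (hz0 s) _ _)]
      rw [(hC.integrable_pathDens n 0 s _ (hz0 s)).2, mul_one]
    · simp only [Fin.cons_zero]
      exact (hρ.1.comp_fst).mul (hC.measurable_pathDens 0 hzx
        measurable_extend_cons_pair n).aestronglyMeasurable
  · exact (hF.comp_measurable (((measurable_pi_apply n).comp measurable_extend).prodMk
      (hC.measurable_path 0 (hz.comp (measurable_pi_apply 0)) measurable_extend
        n))).aestronglyMeasurable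

theorem integral_trajectory [CompleteSpace V] (hC : C.IsMarkov) {ρ : S → ℝ}
    (hρ : Integrable ρ C.vol) {z : S → Z} (hz : Measurable z) (hz0 : ∀ s, z s ∈ C.dom 0)
    {F : S → Z → V} (hF : StronglyMeasurable fun w : S × Z => F w.1 w.2) {R : ℝ} {n : ℕ}
    (hR : ∀ s, ∀ z ∈ C.dom n, ‖F s z‖ ≤ R) :
    ∫ x : Fin (n + 1) → S, (ρ (x 0) * C.pathDens 0 (z (x 0)) (extend x) n) •
        F (extend x n) (C.path 0 (z (x 0)) (extend x) n) ∂(Measure.pi fun _ => C.vol) =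
      ∫ s, ρ s • C.val F n 0 s (z s) ∂C.vol := by
  have := hC.sigmaFinite
  have hint := hC.integrable_trajectory hρ hz hz0 hF hR
  rw [integrable_fin_cons_iff] at hint
  rw [integral_fin_cons, integral_prod _ hint]
  refine integral_congr_ae (ae_of_all _ fun s => ?_)
  simp only [Fin.cons_zero, mul_smul]
  rw [integral_smul, hC.integral_pathDens_smul hF n (by simpa using hR) s (hz0 s)]

/-- The solution of the recursion `Y (n + 1) = src (n + 1) + (transition operator) (Y n)`. -/
theorem eq_sum_val (hC : C.IsMarkov) {Y src : ℕ → ℕ → S → Z → V}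
    (hsrc : ∀ i t, StronglyMeasurable fun w : S × Z => src i t w.1 w.2)
    (hbdd : ∀ i t, ∃ R, ∀ s, ∀ z ∈ C.dom t, ‖src i t s z‖ ≤ R)
    (h0 : ∀ t s, ∀ z ∈ C.dom t, Y 0 t s z = src 0 t s z)
    (hstep : ∀ n t s, ∀ z ∈ C.dom t, Y (n + 1) t s z =
      src (n + 1) t s z + ∫ s', C.dens s z s' • Y n (t + 1) s' (C.next t s z s') ∂C.vol)
    (n : ℕ) : ∀ (t : ℕ) (s : S), ∀ z ∈ C.dom t,
    Y n t s z = ∑ j ∈ Finset.range (n + 1), C.val (src (n - j) (t + j)) j t s z := by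
  have := hC.sigmaFinite
  induction n with
  | zero =>
    intro t s z hz
    simpa [val] using h0 t s z hz
  | succ n ih =>
    intro t s z hz
    -- The term j = 0 is the source itself; the term j + 1 is one transition applied to the term j
    -- of the solution started at time t + 1.
    rw [hstep n t s z hz, Finset.sum_range_succ', add_comm]
    congr 1
    have : ∀ s', C.dens s z s' • Y n (t + 1) s' (C.next t s z s') =
        ∑ j ∈ Finset.range (n + 1), C.dens s z s' •
          C.val (src (n - j) (t + 1 + j)) j (t + 1) s' (C.next t s z s') := fun s' => by
      rw [ih (t + 1) s' _ (hC.next_mem t s z hz s'), Finset.smul_sum]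
    simp only [this]
    rw [integral_finsetSum]
    · refine Finset.sum_congr rfl fun j _ => ?_
      rw [val, show n + 1 - (j + 1) = n - j by omega, show t + (j + 1) = t + 1 + j by omega]
    · intro j _
      obtain ⟨R, hR⟩ := hbdd (n - j) (t + 1 + j)
      refine hC.integrable_dens_smul hz s ?_
        (fun s' => hC.norm_val_le hR s' (hC.next_mem t s z hz s'))
      exact ((hC.stronglyMeasurable_val (hsrc _ _) j (t + 1)).comp_measurable
        (measurable_id.prodMk ((hC.next_meas t).comp (measurable_const.prodMk
          (measurable_const.prodMk measurable_id))))).aestronglyMeasurable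

end AuxChain.IsMarkov

/-! ### Measurable dependence of derivatives on parameters -/

section MeasurableDerivative

variable {X : Type*} [MeasurableSpace X] {n : ℕ} {F : Type*} [NormedAddCommGroup F]
  [NormedSpace ℝ F] [FiniteDimensional ℝ F] [MeasurableSpace F] [BorelSpace F]

/-- A linear map on a finite-dimensional space is a finite combination of its values on a basis, so
measurability of operators reduces to that of directional derivatives. -/
theorem measurable_clm_of_apply {L : X → EuclideanSpace ℝ (Fin n) →L[ℝ] F}
    (h : ∀ v, Measurable fun x => L x v) : Measurable L := by
  have := FiniteDimensional.proper_real F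
  have heq : L = fun x => ∑ i, (EuclideanSpace.proj i : EuclideanSpace ℝ (Fin n) →L[ℝ] ℝ).smulRight
      (L x (EuclideanSpace.single i 1)) := by
    funext x
    ext v
    conv_lhs => rw [← (EuclideanSpace.basisFun (Fin n) ℝ).sum_repr v]
    simp [map_sum]
  rw [heq]
  refine Finset.measurable_sum _ fun i _ => ?_
  have hc : Continuous fun f : F =>
      (EuclideanSpace.proj i : EuclideanSpace ℝ (Fin n) →L[ℝ] ℝ).smulRight f :=
    (ContinuousLinearMap.smulRightL ℝ (EuclideanSpace ℝ (Fin n)) F (EuclideanSpace.proj i)).continuous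
  exact hc.measurable.comp (h _)

/-- A directional derivative is the pointwise limit of difference quotients with step 1/c.
Measurability is asked only for large c, because the policy is known to be measurable only for
parameters in `Θ`, which the shifted point enters eventually. -/
theorem measurable_fderiv_at {f : X → EuclideanSpace ℝ (Fin n) → F}
    {y : X → EuclideanSpace ℝ (Fin n)} (hd : ∀ x, DifferentiableAt ℝ (f x) (y x))
    (hm : ∀ v, ∀ᶠ c : ℕ in atTop, Measurable fun x => f x (y x + (c : ℝ)⁻¹ • v))
    (h0 : Measurable fun x => f x (y x)) : Measurable fun x => fderiv ℝ (f x) (y x) := by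
  have := FiniteDimensional.proper_real F
  refine measurable_clm_of_apply fun v => ?_
  obtain ⟨N, hN⟩ := eventually_atTop.1 (hm v)
  -- Shifting the index by N makes every quotient of the sequence measurable.
  have hlim : Tendsto (fun c : ℕ => ‖((c + N : ℕ) : ℝ)‖) atTop atTop :=
    (tendsto_natCast_atTop_atTop.comp (tendsto_add_atTop_nat N)).congr fun c =>
      (Real.norm_of_nonneg (Nat.cast_nonneg _)).symm
  refine measurable_of_tendsto_metrizable (f := fun (c : ℕ) x => ((c + N : ℕ) : ℝ) •
    (f x (y x + ((c + N : ℕ) : ℝ)⁻¹ • v) - f x (y x))) (fun c => ?_) (tendsto_pi_nhds.2 fun x =>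
      (hd x).hasFDerivAt.lim v hlim)
  exact ((hN _ (Nat.le_add_left N c)).sub h0).const_smul _

/-- The derivative of `f` on `O`, continued by `0`. -/
noncomputable def fderivOn {E F : Type*} [NormedAddCommGroup E] [NormedSpace ℝ E]
    [NormedAddCommGroup F] [NormedSpace ℝ F] (O : Set E) (f : E → F) (x : E) : E →L[ℝ] F :=
  open Classical in if x ∈ O then fderiv ℝ f x else 0

omit [FiniteDimensional ℝ F] [MeasurableSpace F] [BorelSpace F] in
theorem fderivOn_of_mem {O : Set (EuclideanSpace ℝ (Fin n))} {f : EuclideanSpace ℝ (Fin n) → F}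
    {x : EuclideanSpace ℝ (Fin n)} (hx : x ∈ O) : fderivOn O f x = fderiv ℝ f x :=
  if_pos hx

theorem measurable_fderivOn {f : X → EuclideanSpace ℝ (Fin n) → F}
    (hf : Measurable fun w : X × EuclideanSpace ℝ (Fin n) => f w.1 w.2)
    {O : Set (EuclideanSpace ℝ (Fin n))} (hO : IsOpen O)
    (hd : ∀ x, ∀ y ∈ O, DifferentiableAt ℝ (f x) y) :
    Measurable fun w : X × EuclideanSpace ℝ (Fin n) => fderivOn O (f w.1) w.2 := by
  have hs : MeasurableSet {w : X × EuclideanSpace ℝ (Fin n) | w.2 ∈ O} :=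
    measurable_snd hO.measurableSet
  refine measurable_of_restrict_of_restrict_compl hs ?_ ?_
  · have h1 : Measurable fun w : {w : X × EuclideanSpace ℝ (Fin n) | w.2 ∈ O} =>
        fderiv ℝ (f w.1.1) w.1.2 := by
      refine measurable_fderiv_at (fun w => hd _ _ w.2) (fun v => Eventually.of_forall fun c => ?_)
        (hf.comp measurable_subtype_coe)
      exact hf.comp ((measurable_fst.comp measurable_subtype_coe).prodMk
        ((measurable_snd.comp measurable_subtype_coe).add_const _))
    convert h1 using 2 with w
    exact if_pos w.2
  · convert measurable_const (a := (0 : EuclideanSpace ℝ (Fin n) →L[ℝ] F)) using 2 with w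
    exact if_neg w.2

end MeasurableDerivative

/-! ### The chain of goals and the chain of goals with their Jacobians -/

namespace HRLModel

/-- Euclidean space. -/
abbrev Vec (n : ℕ) := EuclideanSpace ℝ (Fin n)

variable {S V : Type*} [MeasurableSpace S] {m q d : ℕ}
  [NormedAddCommGroup V] [NormedSpace ℝ V]

/-- The chain of states and goals. -/
noncomputable def goalChain (M : HRLModel S m q d) (θ : Vec d) : AuxChain S (Vec q) where
  vol := M.vol
  dens s g s' := M.p s (M.polW s g) s'
  next t s g s' := M.nextGoal θ t s g s'
  dom _ := M.G

/-- `∇_a p(s' | s, a)`. -/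
noncomputable def dp (M : HRLModel S m q d) (s : S) (a : Vec m) (s' : S) : Vec m →L[ℝ] ℝ :=
  fderivOn M.A (fun a' => M.p s a' s') a

/-- The Jacobian of `π_w(s, ·)`. -/
noncomputable def dpolW (M : HRLModel S m q d) (s : S) (g : Vec q) : Vec q →L[ℝ] Vec m :=
  fderivOn M.G (M.polW s) g

/-- The Jacobian of `h(s, ·, s')`. -/
noncomputable def dh (M : HRLModel S m q d) (s : S) (g : Vec q) (s' : S) : Vec q →L[ℝ] Vec q :=
  fderivOn M.G (fun g' => M.h s g' s') g

/-- The Jacobian of `π_m(s)` with respect to the parameter. -/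
noncomputable def dpolM (M : HRLModel S m q d) (θ : Vec d) (s : S) : Vec d →L[ℝ] Vec q :=
  fderiv ℝ (fun θ' => M.polM θ' s) θ

/-- The Jacobian of the next goal along a curve of parameters and goals, as a function of the
Jacobian `D` of the present goal. -/
noncomputable def dnext (M : HRLModel S m q d) (θ : Vec d) (t : ℕ) (s : S) (g : Vec q)
    (D : Vec d →L[ℝ] Vec q) (s' : S) : Vec d →L[ℝ] Vec q :=
  if (t + 1) % M.k = 0 then M.dpolM θ s' else (M.dh s g s').comp D

/-- The Jacobian of the next goal with respect to the parameter and the present goal. -/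
noncomputable def dnextPair (M : HRLModel S m q d) (θ : Vec d) (t : ℕ) (s : S) (g : Vec q)
    (s' : S) : Vec d × Vec q →L[ℝ] Vec q :=
  if (t + 1) % M.k = 0 then (M.dpolM θ s').comp (ContinuousLinearMap.fst ℝ _ _)
  else (M.dh s g s').comp (ContinuousLinearMap.snd ℝ _ _)

/-- The chain of states, goals, and Jacobians of the goals with respect to the parameter. -/
noncomputable def jacobianChain (M : HRLModel S m q d) (θ : Vec d) (L : ℝ) :
    AuxChain S (Vec q × (Vec d →L[ℝ] Vec q)) where
  vol := M.vol
  dens s z s' := M.p s (M.polW s z.1) s'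
  next t s z s' := (M.nextGoal θ t s z.1 s', M.dnext θ t s z.1 z.2 s')
  -- The exponent counts the last manager decision and the goal transitions since then. It falls
  -- back to 1 at multiples of k, so admissible Jacobians stay bounded uniformly in time.
  dom t := {z | z.1 ∈ M.G ∧ ‖z.2‖ ≤ L ^ (1 + t % M.k)}

/-- A common bound for the derivatives of the data. -/
structure DerivBound (M : HRLModel S m q d) (Θ : Set (Vec d)) (L : ℝ) : Prop where
  one_le : 1 ≤ L
  polM_le : ∀ θ ∈ Θ, ∀ s, ‖M.dpolM θ s‖ ≤ L
  polW_le : ∀ s, ∀ g ∈ M.G, ‖M.dpolW s g‖ ≤ L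
  h_le : ∀ s, ∀ g ∈ M.G, ∀ s', ‖M.dh s g s'‖ ≤ L
  p_le : ∀ s, ∀ a ∈ M.A, ∫ s', ‖M.dp s a s'‖ ∂M.vol ≤ L

/-- A measurable, bounded and differentiable reward, with bounded derivative, which depends on the
state and the goal. -/
structure IsReward (M : HRLModel S m q d) (f : S → Vec q → ℝ) (R L : ℝ) : Prop where
  meas : Measurable fun w : S × Vec q => f w.1 w.2
  le : ∀ s, ∀ g ∈ M.G, |f s g| ≤ R
  diff : ∀ s, ∀ g ∈ M.G, DifferentiableAt ℝ (f s) g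
  fderiv_le : ∀ s, ∀ g ∈ M.G, ‖fderivOn M.G (f s) g‖ ≤ L
  R_nonneg : 0 ≤ R
  L_nonneg : 0 ≤ L

variable {M : HRLModel S m q d} {Θ : Set (Vec d)} {θ : Vec d} {L : ℝ}

theorem norm_gradient_eq {n : ℕ} (f : Vec n → ℝ) (x : Vec n) : ‖gradient f x‖ = ‖fderiv ℝ f x‖ :=
  LinearIsometryEquiv.norm_map _ _

namespace Regular

theorem exists_derivBound (hM : M.Regular Θ) : ∃ L, M.DerivBound Θ L := by
  obtain ⟨L1, h1⟩ := hM.polM_fderiv_bdd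
  obtain ⟨L2, h2⟩ := hM.polW_fderiv_bdd
  obtain ⟨L3, h3⟩ := hM.h_fderiv_bdd
  obtain ⟨L4, h4⟩ := hM.p_grad_L1_bdd
  -- The entry 1 makes the powers of L increasing in the exponent.
  refine ⟨max 1 (max L1 (max L2 (max L3 L4))), le_max_left _ _, fun θ hθ s => ?_, fun s g hg => ?_,
    fun s g hg s' => ?_, fun s a ha => ?_⟩
  · exact (h1 θ hθ s).trans (by simp)
  · rw [dpolW, fderivOn_of_mem hg]
    exact (h2 s g hg).trans (by simp)
  · rw [dh, fderivOn_of_mem hg]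
    exact (h3 s g hg s').trans (by simp)
  · simp only [dp, fderivOn_of_mem ha, ← norm_gradient_eq]
    exact (h4 s a ha).trans (by simp)

theorem hasFDerivAt_p (hM : M.Regular Θ) (s : S) {a : Vec m} (ha : a ∈ M.A) (s' : S) :
    HasFDerivAt (fun a' => M.p s a' s') (M.dp s a s') a := by
  rw [dp, fderivOn_of_mem ha]
  exact (hM.p_diff s a ha s').hasFDerivAt

theorem hasFDerivAt_polW (hM : M.Regular Θ) (s : S) {g : Vec q} (hg : g ∈ M.G) :
    HasFDerivAt (M.polW s) (M.dpolW s g) g := by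
  rw [dpolW, fderivOn_of_mem hg]
  exact (hM.polW_diff s g hg).hasFDerivAt

theorem hasFDerivAt_h (hM : M.Regular Θ) (s : S) {g : Vec q} (hg : g ∈ M.G) (s' : S) :
    HasFDerivAt (fun g' => M.h s g' s') (M.dh s g s') g := by
  rw [dh, fderivOn_of_mem hg]
  exact (hM.h_diff s g hg s').hasFDerivAt

theorem hasFDerivAt_polM (hM : M.Regular Θ) (hθ : θ ∈ Θ) (s : S) :
    HasFDerivAt (fun θ' => M.polM θ' s) (M.dpolM θ s) θ :=
  (hM.polM_diff θ hθ s).hasFDerivAt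

theorem measurable_dp (hM : M.Regular Θ) :
    Measurable fun w : S × Vec m × S => M.dp w.1 w.2.1 w.2.2 := by
  have h1 : Measurable fun w : (S × S) × Vec m =>
      fderivOn M.A (fun a' => M.p w.1.1 a' w.1.2) w.2 := by
    refine measurable_fderivOn (f := fun (x : S × S) a' => M.p x.1 a' x.2) ?_ hM.isOpen_A
      fun x y hy => hM.p_diff x.1 y hy x.2
    exact hM.p_meas.comp (by fun_prop : Measurable fun w : (S × S) × Vec m =>
      (w.1.1, w.2, w.1.2))
  exact h1.comp (by fun_prop : Measurable fun w : S × Vec m × S => ((w.1, w.2.2), w.2.1))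

theorem measurable_dpolW (hM : M.Regular Θ) : Measurable fun w : S × Vec q => M.dpolW w.1 w.2 :=
  measurable_fderivOn hM.polW_meas hM.isOpen_G hM.polW_diff

theorem measurable_dh (hM : M.Regular Θ) :
    Measurable fun w : S × Vec q × S => M.dh w.1 w.2.1 w.2.2 := by
  have h1 : Measurable fun w : (S × S) × Vec q =>
      fderivOn M.G (fun g' => M.h w.1.1 g' w.1.2) w.2 := by
    refine measurable_fderivOn (f := fun (x : S × S) g' => M.h x.1 g' x.2) ?_ hM.isOpen_G
      fun x y hy => hM.h_diff x.1 y hy x.2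
    exact hM.h_meas.comp (by fun_prop : Measurable fun w : (S × S) × Vec q =>
      (w.1.1, w.2, w.1.2))
  exact h1.comp (by fun_prop : Measurable fun w : S × Vec q × S => ((w.1, w.2.2), w.2.1))

theorem eventually_add_inv_smul_mem {n : ℕ} {O : Set (Vec n)} (hO : IsOpen O) {x : Vec n}
    (hx : x ∈ O) (v : Vec n) : ∀ᶠ c : ℕ in atTop, x + (c : ℝ)⁻¹ • v ∈ O := by
  have h : Tendsto (fun c : ℕ => x + (c : ℝ)⁻¹ • v) atTop (𝓝 (x + (0 : ℝ) • v)) :=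
    tendsto_const_nhds.add ((tendsto_inv_atTop_nhds_zero_nat (𝕜 := ℝ)).smul_const v)
  rw [zero_smul, add_zero] at h
  exact h.eventually_mem (hO.mem_nhds hx)

theorem measurable_dpolM (hM : M.Regular Θ) (hθ : θ ∈ Θ) : Measurable (M.dpolM θ) := by
  refine measurable_fderiv_at (f := fun s θ' => M.polM θ' s) (y := fun _ => θ)
    (fun s => hM.polM_diff θ hθ s) (fun v => ?_) (hM.polM_meas θ hθ)
  filter_upwards [eventually_add_inv_smul_mem hM.isOpen_param hθ v] with c hc
  exact hM.polM_meas _ hc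

theorem nextGoal_mem (hM : M.Regular Θ) (hθ : θ ∈ Θ) (t : ℕ) (s : S) {g : Vec q} (hg : g ∈ M.G)
    (s' : S) : M.nextGoal θ t s g s' ∈ M.G := by
  unfold nextGoal
  split_ifs
  exacts [hM.polM_mem θ hθ s', hM.h_mem s g hg s']

theorem measurable_nextGoal (hM : M.Regular Θ) (hθ : θ ∈ Θ) (t : ℕ) :
    Measurable fun w : S × Vec q × S => M.nextGoal θ t w.1 w.2.1 w.2.2 := by
  unfold nextGoal
  split_ifs
  exacts [(hM.polM_meas θ hθ).comp (measurable_snd.comp measurable_snd), hM.h_meas]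

theorem measurable_policy_dens (hM : M.Regular Θ) :
    Measurable fun w : S × Vec q × S => M.p w.1 (M.polW w.1 w.2.1) w.2.2 :=
  hM.p_meas.comp (measurable_fst.prodMk
    ((hM.polW_meas.comp (by fun_prop : Measurable fun w : S × Vec q × S => (w.1, w.2.1))).prodMk
      (by fun_prop)))

theorem isMarkov_goalChain (hM : M.Regular Θ) (hθ : θ ∈ Θ) : (M.goalChain θ).IsMarkov where
  sigmaFinite := hM.sigmaFinite
  dens_meas := hM.measurable_policy_dens
  next_meas := hM.measurable_nextGoal hθ
  dens_nonneg _ s g hg := hM.p_nonneg s _ (hM.polW_mem s g hg)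
  dens_integral _ s g hg := hM.p_integral s _ (hM.polW_mem s g hg)
  next_mem t s _ hg := hM.nextGoal_mem hθ t s hg

theorem measurable_dnext (hM : M.Regular Θ) (hθ : θ ∈ Θ) (t : ℕ) :
    Measurable fun w : S × (Vec q × (Vec d →L[ℝ] Vec q)) × S =>
      M.dnext θ t w.1 w.2.1.1 w.2.1.2 w.2.2 := by
  unfold dnext
  split_ifs
  · exact (hM.measurable_dpolM hθ).comp (measurable_snd.comp measurable_snd)
  · have h1 : Measurable fun w : S × (Vec q × (Vec d →L[ℝ] Vec q)) × S =>
        M.dh w.1 w.2.1.1 w.2.2 :=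
      hM.measurable_dh.comp (by fun_prop :
        Measurable fun w : S × (Vec q × (Vec d →L[ℝ] Vec q)) × S => (w.1, w.2.1.1, w.2.2))
    have h2 : Continuous fun w : (Vec q →L[ℝ] Vec q) × (Vec d →L[ℝ] Vec q) => w.1.comp w.2 :=
      continuous_fst.clm_comp continuous_snd
    exact h2.measurable.comp (h1.prodMk (by fun_prop))

theorem measurable_dnextPair (hM : M.Regular Θ) (hθ : θ ∈ Θ) (t : ℕ) :
    Measurable fun w : S × Vec q × S => M.dnextPair θ t w.1 w.2.1 w.2.2 := by
  unfold dnextPair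
  split_ifs
  · exact ((continuous_id.clm_comp_const _).measurable.comp (hM.measurable_dpolM hθ)).comp
      (measurable_snd.comp measurable_snd)
  · exact (continuous_id.clm_comp_const _).measurable.comp hM.measurable_dh

/-- After a change of phase from `t` to `t + 1`, the bound `L ^ (1 + t % k) * c` for tangent vectors
of goals persists. -/
theorem norm_dnextPair_le (hM : M.Regular Θ) (hL : M.DerivBound Θ L) (hθ : θ ∈ Θ) (t : ℕ) (s : S)
    {g : Vec q} (hg : g ∈ M.G) (s' : S) {c : ℝ} {v : Vec d × Vec q} (h1 : ‖v.1‖ ≤ c)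
    (h2 : ‖v.2‖ ≤ L ^ (1 + t % M.k) * c) :
    ‖M.dnextPair θ t s g s' v‖ ≤ L ^ (1 + (t + 1) % M.k) * c := by
  have hL0 : 0 ≤ L := zero_le_one.trans hL.one_le
  unfold dnextPair
  split_ifs with h
  -- At a manager decision the new goal depends on the parameter alone: the growth accumulated in
  -- the goal direction is forgotten.
  · rw [h, add_zero, pow_one]
    exact (ContinuousLinearMap.le_of_opNorm_le _ (hL.polM_le θ hθ s') _).trans
      (mul_le_mul_of_nonneg_left h1 hL0)
  -- Within a meta-period the residue increases by exactly one, which absorbs the factor L coming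
  -- from `h`.
  · have hk : (t + 1) % M.k = t % M.k + 1 := by
      have := Nat.mod_lt t hM.k_pos
      rw [← Nat.mod_add_mod] at h ⊢
      exact Nat.mod_eq_of_lt (lt_of_le_of_ne this fun h3 => h (by rw [h3, Nat.mod_self]))
    refine (ContinuousLinearMap.le_of_opNorm_le _ (hL.h_le s g hg s') _).trans ?_
    rw [hk, ← add_assoc, pow_succ', mul_assoc]
    exact mul_le_mul_of_nonneg_left h2 hL0

theorem dnext_apply (t : ℕ) (s : S) (g : Vec q) (D : Vec d →L[ℝ] Vec q) (s' : S) (v : Vec d) :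
    M.dnext θ t s g D s' v = M.dnextPair θ t s g s' (v, D v) := by
  unfold dnext dnextPair
  split_ifs <;> rfl

theorem isMarkov_jacobianChain (hM : M.Regular Θ) (hL : M.DerivBound Θ L) (hθ : θ ∈ Θ) :
    (M.jacobianChain θ L).IsMarkov where
  sigmaFinite := hM.sigmaFinite
  dens_meas := hM.measurable_policy_dens.comp (by fun_prop :
    Measurable fun w : S × (Vec q × (Vec d →L[ℝ] Vec q)) × S => (w.1, w.2.1.1, w.2.2))
  next_meas t := ((hM.measurable_nextGoal hθ t).comp (by fun_prop :
    Measurable fun w : S × (Vec q × (Vec d →L[ℝ] Vec q)) × S => (w.1, w.2.1.1, w.2.2))).prodMk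
      (hM.measurable_dnext hθ t)
  dens_nonneg _ s z hz := hM.p_nonneg s _ (hM.polW_mem s z.1 hz.1)
  dens_integral _ s z hz := hM.p_integral s _ (hM.polW_mem s z.1 hz.1)
  next_mem t s z hz s' := by
    have hL0 : 0 ≤ L := zero_le_one.trans hL.one_le
    refine ⟨hM.nextGoal_mem hθ t s hz.1 s',
      ContinuousLinearMap.opNorm_le_bound _ (by positivity) fun v => ?_⟩
    change ‖M.dnext θ t s z.1 z.2 s' v‖ ≤ _
    rw [dnext_apply]
    -- The tangent vector (v, D v) satisfies the phase bound with c = ‖v‖.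
    exact hM.norm_dnextPair_le hL hθ t s hz.1 s' le_rfl
      (ContinuousLinearMap.le_of_opNorm_le _ hz.2 _)

end Regular

theorem goalChain_vol : (M.goalChain θ).vol = M.vol := rfl

theorem jacobianChain_vol : (M.jacobianChain θ L).vol = M.vol := rfl

theorem path_goalChain (t : ℕ) (g : Vec q) (x : ℕ → S) (j : ℕ) :
    (M.goalChain θ).path t g x j = M.goalFrom θ t g x j := by
  induction j with
  | zero => rfl
  | succ j ih => rw [AuxChain.path, ih]; rfl

theorem path_jacobianChain_fst (t : ℕ) (z : Vec q × (Vec d →L[ℝ] Vec q)) (x : ℕ → S) (j : ℕ) :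
    ((M.jacobianChain θ L).path t z x j).1 = M.goalFrom θ t z.1 x j := by
  induction j with
  | zero => rfl
  | succ j ih => rw [AuxChain.path, goalFrom, ← ih]; rfl

theorem pathDens_goalChain (t : ℕ) (g : Vec q) (x : ℕ → S) (n : ℕ) :
    (M.goalChain θ).pathDens t g x n = M.transDensity θ t g x n :=
  Finset.prod_congr rfl fun j _ => by rw [path_goalChain]; rfl

theorem pathDens_jacobianChain (t : ℕ) (z : Vec q × (Vec d →L[ℝ] Vec q)) (x : ℕ → S) (n : ℕ) :
    (M.jacobianChain θ L).pathDens t z x n = M.transDensity θ t z.1 x n :=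
  Finset.prod_congr rfl fun j _ => by rw [← path_jacobianChain_fst (L := L) t z x j]; rfl

theorem Regular.goalFrom_mem (hM : M.Regular Θ) (hθ : θ ∈ Θ) (t : ℕ) {g : Vec q} (hg : g ∈ M.G)
    (x : ℕ → S) (j : ℕ) : M.goalFrom θ t g x j ∈ M.G := by
  rw [← path_goalChain]
  exact (hM.isMarkov_goalChain hθ).path_mem (t := t) hg x j

theorem Regular.goal_mem (hM : M.Regular Θ) (hθ : θ ∈ Θ) (x : ℕ → S) (t : ℕ) :
    M.goal θ x t ∈ M.G :=
  hM.goalFrom_mem hθ 0 (hM.polM_mem θ hθ _) x t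

/-- The Jacobian chain follows the derivative of the goals with respect to the parameter. -/
theorem Regular.hasFDerivAt_goal (hM : M.Regular Θ) (hθ : θ ∈ Θ) (x : ℕ → S) (t : ℕ) :
    HasFDerivAt (fun θ' => M.goal θ' x t)
      ((M.jacobianChain θ L).path 0 (M.polM θ (x 0), M.dpolM θ (x 0)) x t).2 θ := by
  induction t with
  | zero => exact hM.hasFDerivAt_polM hθ (x 0)
  | succ t ih =>
    have hp : ((M.jacobianChain θ L).path 0 (M.polM θ (x 0), M.dpolM θ (x 0)) x (t + 1)).2 =
        M.dnext θ t (x t) (M.goal θ x t)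
          ((M.jacobianChain θ L).path 0 (M.polM θ (x 0), M.dpolM θ (x 0)) x t).2 (x (t + 1)) := by
      rw [AuxChain.path, goal, ← path_jacobianChain_fst (L := L) 0 (_, M.dpolM θ (x 0)) x t]
      simp [jacobianChain]
    rw [hp]
    have hg : ∀ θ', M.goal θ' x (t + 1) = M.nextGoal θ' t (x t) (M.goal θ' x t) (x (t + 1)) :=
      fun θ' => by simp [goal, goalFrom]
    simp only [hg, nextGoal, dnext]
    split_ifs
    · exact hM.hasFDerivAt_polM hθ _
    · exact (hM.hasFDerivAt_h (x t) (hM.goal_mem hθ x t) (x (t + 1))).comp θ ih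

omit [MeasurableSpace S] in
theorem extend_zero {n : ℕ} (x : Fin (n + 1) → S) : extend x 0 = x 0 := by
  simp [extend]

theorem Regular.integrable_ρ₀ (hM : M.Regular Θ) : Integrable M.ρ₀ M.vol := by
  by_contra h
  simpa [integral_undef h] using hM.ρ₀_integral

/-! ### Expectations of the hierarchy as values of chains -/

section Expectation

variable {F : S → Vec q → V}

theorem Regular.condExpect_eq_val (hM : M.Regular Θ) (hθ : θ ∈ Θ) {F : S → Vec q → ℝ}
    (hF : Measurable fun w : S × Vec q => F w.1 w.2) {R : ℝ}
    (hR : ∀ s, ∀ g ∈ M.G, |F s g| ≤ R) (t : ℕ) (s : S) {g : Vec q} (hg : g ∈ M.G) (n : ℕ) :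
    M.condExpect θ t s g n (fun x => F (x n) (M.goalFrom θ t g x n)) =
      (M.goalChain θ).val F n t s g := by
  rw [← (hM.isMarkov_goalChain hθ).integral_pathDens_smul hF.stronglyMeasurable n
    (R := R) hR s hg]
  simp only [pathDens_goalChain, path_goalChain, smul_eq_mul]
  rfl

theorem Regular.expectIntegrable (hM : M.Regular Θ) (hθ : θ ∈ Θ)
    (hF : StronglyMeasurable fun w : S × Vec q => F w.1 w.2) {R : ℝ}
    (hR : ∀ s, ∀ g ∈ M.G, ‖F s g‖ ≤ R) (n : ℕ) :
    M.ExpectIntegrable θ n fun x => F (x n) (M.goal θ x n) := by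
  have := (hM.isMarkov_goalChain hθ).integrable_trajectory hM.integrable_ρ₀ (hM.polM_meas θ hθ)
    (hM.polM_mem θ hθ) hF (n := n) hR
  simpa only [goalChain_vol, pathDens_goalChain, path_goalChain, ExpectIntegrable, trajDensity, goal,
    extend_zero] using this

theorem Regular.expect_eq (hM : M.Regular Θ) (hθ : θ ∈ Θ) [CompleteSpace V]
    (hF : StronglyMeasurable fun w : S × Vec q => F w.1 w.2) {R : ℝ}
    (hR : ∀ s, ∀ g ∈ M.G, ‖F s g‖ ≤ R) (n : ℕ) :
    M.expect θ n (fun x => F (x n) (M.goal θ x n)) =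
      ∫ s, M.ρ₀ s • (M.goalChain θ).val F n 0 s (M.polM θ s) ∂M.vol := by
  have := (hM.isMarkov_goalChain hθ).integral_trajectory hM.integrable_ρ₀ (hM.polM_meas θ hθ)
    (hM.polM_mem θ hθ) hF (n := n) hR
  simpa only [goalChain_vol, pathDens_goalChain, path_goalChain, expect, trajDensity, goal,
    extend_zero] using this

variable {F : S → Vec q × (Vec d →L[ℝ] Vec q) → V}

theorem Regular.polM_mem_jacobianChain (hM : M.Regular Θ) (hL : M.DerivBound Θ L) (hθ : θ ∈ Θ)
    (s : S) : (M.polM θ s, M.dpolM θ s) ∈ (M.jacobianChain θ L).dom 0 :=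
  ⟨hM.polM_mem θ hθ s, by simpa using hL.polM_le θ hθ s⟩

theorem Regular.path_jacobianChain_eq (hM : M.Regular Θ) (hθ : θ ∈ Θ) (x : ℕ → S) (t : ℕ) :
    (M.jacobianChain θ L).path 0 (M.polM θ (x 0), M.dpolM θ (x 0)) x t =
      (M.goal θ x t, fderiv ℝ (fun θ' => M.goal θ' x t) θ) :=
  Prod.ext (path_jacobianChain_fst _ _ _ _) (hM.hasFDerivAt_goal hθ x t).fderiv.symm

theorem Regular.expectIntegrable_jacobian (hM : M.Regular Θ) (hL : M.DerivBound Θ L) (hθ : θ ∈ Θ)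
    {n : ℕ} (hF : StronglyMeasurable fun w : S × (Vec q × (Vec d →L[ℝ] Vec q)) => F w.1 w.2) {R : ℝ}
    (hR : ∀ s, ∀ z ∈ (M.jacobianChain θ L).dom n, ‖F s z‖ ≤ R) :
    M.ExpectIntegrable θ n
      fun x => F (x n) (M.goal θ x n, fderiv ℝ (fun θ' => M.goal θ' x n) θ) := by
  have := (hM.isMarkov_jacobianChain hL hθ).integrable_trajectory hM.integrable_ρ₀
    ((hM.polM_meas θ hθ).prodMk (hM.measurable_dpolM hθ)) (hM.polM_mem_jacobianChain hL hθ) hF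
    (n := n) hR
  simpa only [jacobianChain_vol, pathDens_jacobianChain, ExpectIntegrable, trajDensity, ← extend_zero,
    hM.path_jacobianChain_eq hθ] using this

theorem Regular.expect_jacobian_eq (hM : M.Regular Θ) (hL : M.DerivBound Θ L) (hθ : θ ∈ Θ)
    [CompleteSpace V]
    {n : ℕ} (hF : StronglyMeasurable fun w : S × (Vec q × (Vec d →L[ℝ] Vec q)) => F w.1 w.2) {R : ℝ}
    (hR : ∀ s, ∀ z ∈ (M.jacobianChain θ L).dom n, ‖F s z‖ ≤ R) :
    M.expect θ n (fun x => F (x n) (M.goal θ x n, fderiv ℝ (fun θ' => M.goal θ' x n) θ)) =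
      ∫ s, M.ρ₀ s • (M.jacobianChain θ L).val F n 0 s (M.polM θ s, M.dpolM θ s) ∂M.vol := by
  have := (hM.isMarkov_jacobianChain hL hθ).integral_trajectory hM.integrable_ρ₀
    ((hM.polM_meas θ hθ).prodMk (hM.measurable_dpolM hθ)) (hM.polM_mem_jacobianChain hL hθ) hF
    (n := n) hR
  simpa only [jacobianChain_vol, pathDens_jacobianChain, expect, trajDensity, ← extend_zero,
    hM.path_jacobianChain_eq hθ] using this

end Expectation

end HRLModel

theorem integral_clm_comp {X E F G : Type*} [MeasurableSpace X] {μ : Measure X}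
    [NormedAddCommGroup E] [NormedSpace ℝ E] [NormedAddCommGroup F] [NormedSpace ℝ F]
    [NormedAddCommGroup G] [NormedSpace ℝ G] [CompleteSpace G] {φ : X → F →L[ℝ] G}
    (hφ : Integrable φ μ) (D : E →L[ℝ] F) :
    Integrable (fun x => (φ x).comp D) μ ∧ ∫ x, (φ x).comp D ∂μ = (∫ x, φ x ∂μ).comp D :=
  ⟨((ContinuousLinearMap.compL ℝ E F G).flip D).integrable_comp hφ,
    ((ContinuousLinearMap.compL ℝ E F G).flip D).integral_comp_comm hφ⟩

/-! ### Differentiating the value in the parameter and the goal -/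

namespace HRLModel

variable {S V : Type*} [MeasurableSpace S] {m q d : ℕ}
  [NormedAddCommGroup V] [NormedSpace ℝ V]

/-- The expectation of the reward `f` at time `t + n`, given the state `s` and the goal `g` of time
`t`. -/
noncomputable def value (M : HRLModel S m q d) (f : S → Vec q → ℝ) (θ : Vec d) (n t : ℕ) (s : S)
    (g : Vec q) : ℝ :=
  (M.goalChain θ).val f n t s g

/-- The derivative of the expectation of `W s'` with respect to the action. -/
noncomputable def actDeriv (M : HRLModel S m q d) (s : S) (a : Vec m) (W : S → ℝ) :
    Vec m →L[ℝ] ℝ :=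
  ∫ s', W s' • M.dp s a s' ∂M.vol

/-- The derivative of `value` with respect to the goal that comes from the immediate effect of the
goal: the reward, if there is no further transition, and the action otherwise. -/
noncomputable def immediateDeriv (M : HRLModel S m q d) (f : S → Vec q → ℝ) (θ : Vec d) :
    ℕ → ℕ → S → Vec q → (Vec q →L[ℝ] ℝ)
  | 0, _, s, g => fderivOn M.G (f s) g
  | n + 1, t, s, g => (M.actDeriv s (M.polW s g)
      (fun s' => M.value f θ n (t + 1) s' (M.nextGoal θ t s g s'))).comp (M.dpolW s g)

/-- The derivative of `value` with respect to the parameter and the goal. -/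
noncomputable def dvalue (M : HRLModel S m q d) (f : S → Vec q → ℝ) (θ : Vec d) :
    ℕ → ℕ → S → Vec q → (Vec d × Vec q →L[ℝ] ℝ)
  | 0, t, s, g => (M.immediateDeriv f θ 0 t s g).comp (ContinuousLinearMap.snd ℝ _ _)
  | n + 1, t, s, g =>
    (M.immediateDeriv f θ (n + 1) t s g).comp (ContinuousLinearMap.snd ℝ _ _) +
      ∫ s', M.p s (M.polW s g) s' •
        (M.dvalue f θ n (t + 1) s' (M.nextGoal θ t s g s')).comp
          ((ContinuousLinearMap.fst ℝ _ _).prod (M.dnextPair θ t s g s')) ∂M.vol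

variable {M : HRLModel S m q d} {Θ : Set (Vec d)} {θ : Vec d} {L R K : ℝ} {f : S → Vec q → ℝ}

theorem value_succ (n t : ℕ) (s : S) (g : Vec q) : M.value f θ (n + 1) t s g =
    ∫ s', M.p s (M.polW s g) s' * M.value f θ n (t + 1) s' (M.nextGoal θ t s g s') ∂M.vol := rfl

/-- A crude one-step bound. Iterated, it would grow like a power of L in the horizon, so it serves
only for integrability and domination at a fixed horizon; the true growth is controlled by
`dvalue_bounds`. -/
theorem DerivBound.norm_fst_prod_dnextPair_le (hL : M.DerivBound Θ L) (hθ : θ ∈ Θ) (t : ℕ) (s : S)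
    {g : Vec q} (hg : g ∈ M.G) (s' : S) :
    ‖(ContinuousLinearMap.fst ℝ _ _).prod (M.dnextPair θ t s g s')‖ ≤ L := by
  have hL0 : 0 ≤ L := zero_le_one.trans hL.one_le
  refine ContinuousLinearMap.opNorm_le_bound _ hL0 fun v => ?_
  refine max_le ((norm_fst_le v).trans (le_mul_of_one_le_left (norm_nonneg _) hL.one_le)) ?_
  change ‖M.dnextPair θ t s g s' v‖ ≤ _
  unfold dnextPair
  split_ifs
  · exact (ContinuousLinearMap.le_of_opNorm_le _ (hL.polM_le θ hθ s') _).trans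
      (mul_le_mul_of_nonneg_left (norm_fst_le v) hL0)
  · exact (ContinuousLinearMap.le_of_opNorm_le _ (hL.h_le s g hg s') _).trans
      (mul_le_mul_of_nonneg_left (norm_snd_le v) hL0)

namespace Regular

/-- Only the gradient of the density is assumed to be dominated. The mean value inequality on a ball
of radius r around a then bounds the density itself by p(s' | s, a) + r b(s'), which is integrable.
-/
theorem exists_dominating (hM : M.Regular Θ) (s : S) {a : Vec m} (ha : a ∈ M.A) :
    ∃ U ∈ 𝓝 a, U ⊆ M.A ∧ ∃ b c : S → ℝ, Integrable b M.vol ∧ Integrable c M.vol ∧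
      ∀ a' ∈ U, ∀ s', ‖M.dp s a' s'‖ ≤ b s' ∧ ‖M.p s a' s'‖ ≤ c s' := by
  obtain ⟨ε, hε, b, hb, hbd⟩ := hM.p_grad_dominated s a ha
  obtain ⟨δ, hδ, hball⟩ := Metric.isOpen_iff.1 hM.isOpen_A a ha
  have hsub : Metric.ball a (min ε δ) ⊆ M.A :=
    (Metric.ball_subset_ball (min_le_right _ _)).trans hball
  have hr : 0 < min ε δ := lt_min hε hδ
  have hdp : ∀ a' ∈ Metric.ball a (min ε δ), ∀ s', ‖M.dp s a' s'‖ ≤ b s' := fun a' ha' s' => by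
    rw [dp, fderivOn_of_mem (hsub ha'), ← norm_gradient_eq]
    exact hbd a' ⟨Metric.ball_subset_ball (min_le_left _ _) ha', hsub ha'⟩ s'
  have hpa : Integrable (M.p s a) M.vol := by
    by_contra h
    simpa [integral_undef h] using hM.p_integral s a ha
  refine ⟨_, Metric.ball_mem_nhds a hr, hsub, b,
    fun s' => M.p s a s' + b s' * min ε δ, hb, hpa.add (hb.mul_const _), fun a' ha' s' =>
      ⟨hdp a' ha' s', ?_⟩⟩
  have h1 := (convex_ball a (min ε δ)).norm_image_sub_le_of_norm_hasFDerivWithin_le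
    (f := fun a' => M.p s a' s') (fun x hx => (hM.hasFDerivAt_p s (hsub hx) s').hasFDerivWithinAt)
    (fun x hx => hdp x hx s') (Metric.mem_ball_self hr) ha'
  have h2 : ‖a' - a‖ ≤ min ε δ := (mem_ball_iff_norm.1 ha').le
  have hb0 : 0 ≤ b s' := (norm_nonneg _).trans (hdp a (Metric.mem_ball_self hr) s')
  have h3 := norm_sub_norm_le (M.p s a' s') (M.p s a s')
  rw [Real.norm_of_nonneg (hM.p_nonneg s a ha s')] at h3
  have h4 := mul_le_mul_of_nonneg_left h2 hb0
  linarith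

theorem integrable_dp (hM : M.Regular Θ) (s : S) {a : Vec m} (ha : a ∈ M.A) :
    Integrable (M.dp s a) M.vol := by
  obtain ⟨U, hU, -, b, c, hb, -, h⟩ := hM.exists_dominating s ha
  refine hb.mono' (hM.measurable_dp.comp (by fun_prop :
    Measurable fun s' : S => (s, a, s'))).aestronglyMeasurable
    (ae_of_all _ fun s' => (h a (mem_of_mem_nhds hU) s').1)

theorem integrable_smul_dp (hM : M.Regular Θ) (s : S) {a : Vec m} (ha : a ∈ M.A) {W : S → ℝ}
    (hW : AEStronglyMeasurable W M.vol) (hR : ∀ s', |W s'| ≤ R) :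
    Integrable (fun s' => W s' • M.dp s a s') M.vol :=
  (hM.integrable_dp s ha).bdd_smul R hW (ae_of_all _ hR)

theorem norm_actDeriv_le (hM : M.Regular Θ) (hL : M.DerivBound Θ L) (s : S) {a : Vec m}
    (ha : a ∈ M.A) {W : S → ℝ} (hR0 : 0 ≤ R) (hR : ∀ s', |W s'| ≤ R) :
    ‖M.actDeriv s a W‖ ≤ R * L := by
  refine (norm_integral_le_of_norm_le ((hM.integrable_dp s ha).norm.const_mul R)
    (ae_of_all _ fun s' => ?_)).trans ?_
  · rw [norm_smul]
    exact mul_le_mul_of_nonneg_right (hR s') (norm_nonneg _)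
  · rw [integral_const_mul]
    exact mul_le_mul_of_nonneg_left (hL.p_le s a ha) hR0

theorem hasFDerivAt_integral_p (hM : M.Regular Θ) (s : S) {a : Vec m} (ha : a ∈ M.A) {W : S → ℝ}
    (hW : AEStronglyMeasurable W M.vol) (hR : ∀ s', |W s'| ≤ R) :
    HasFDerivAt (fun a' => ∫ s', M.p s a' s' * W s' ∂M.vol) (M.actDeriv s a W) a := by
  obtain ⟨U, hU, hUA, b, c, hb, hc, h⟩ := hM.exists_dominating s ha
  have hpm : ∀ a', AEStronglyMeasurable (fun s' => M.p s a' s' * W s') M.vol := fun a' =>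
    (hM.p_meas.comp (by fun_prop : Measurable fun s' : S => (s, a', s'))).aestronglyMeasurable.mul
      hW
  refine hasFDerivAt_integral_of_dominated_of_fderiv_le (bound := fun s' => R * b s')
    (F' := fun a' s' => W s' • M.dp s a' s') hU (Eventually.of_forall hpm) ?_
    (hM.integrable_smul_dp s ha hW hR).1 (ae_of_all _ fun s' a' ha' => ?_) (hb.const_mul R)
    (ae_of_all _ fun s' a' ha' => (hM.hasFDerivAt_p s (hUA ha') s').mul_const (W s'))
  · refine (hc.mul_const R).mono' (hpm a) (ae_of_all _ fun s' => ?_)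
    rw [norm_mul]
    exact mul_le_mul (h a (mem_of_mem_nhds hU) s').2 (hR s') (norm_nonneg _)
      ((norm_nonneg _).trans (h a (mem_of_mem_nhds hU) s').2)
  · rw [norm_smul]
    exact mul_le_mul (hR s') (h a' ha' s').1 (norm_nonneg _) ((abs_nonneg _).trans (hR s'))

theorem measurable_value (hM : M.Regular Θ) (hθ : θ ∈ Θ) (hf : M.IsReward f R K) (n t : ℕ) :
    Measurable fun w : S × Vec q => M.value f θ n t w.1 w.2 :=
  ((hM.isMarkov_goalChain hθ).stronglyMeasurable_val hf.meas.stronglyMeasurable n t).measurable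

theorem abs_value_le (hM : M.Regular Θ) (hθ : θ ∈ Θ) (hf : M.IsReward f R K) (n t : ℕ) (s : S)
    {g : Vec q} (hg : g ∈ M.G) : |M.value f θ n t s g| ≤ R :=
  (hM.isMarkov_goalChain hθ).norm_val_le (F := f) (n := n) (t := t) hf.le s hg

theorem measurable_nextGoal_pair (hM : M.Regular Θ) (hθ : θ ∈ Θ) (t : ℕ) :
    Measurable fun w : (S × Vec q) × S => (w.2, M.nextGoal θ t w.1.1 w.1.2 w.2) :=
  measurable_snd.prodMk ((hM.measurable_nextGoal hθ t).comp (by fun_prop :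
    Measurable fun w : (S × Vec q) × S => (w.1.1, w.1.2, w.2)))

theorem measurable_next_value (hM : M.Regular Θ) (hθ : θ ∈ Θ) (hf : M.IsReward f R K) (n t : ℕ)
    (s : S) (g : Vec q) :
    Measurable fun s' => M.value f θ n (t + 1) s' (M.nextGoal θ t s g s') :=
  (hM.measurable_value hθ hf n (t + 1)).comp
    ((hM.measurable_nextGoal_pair hθ t).comp (measurable_prodMk_left (x := (s, g))))

theorem stronglyMeasurable_immediateDeriv (hM : M.Regular Θ) (hθ : θ ∈ Θ)
    (hf : M.IsReward f R K) (n t : ℕ) :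
    StronglyMeasurable fun w : S × Vec q => M.immediateDeriv f θ n t w.1 w.2 := by
  have := hM.sigmaFinite
  cases n with
  | zero => exact (measurable_fderivOn hf.meas hM.isOpen_G hf.diff).stronglyMeasurable
  | succ n =>
    have h1 : StronglyMeasurable fun w : S × Vec q => M.actDeriv w.1 (M.polW w.1 w.2)
        (fun s' => M.value f θ n (t + 1) s' (M.nextGoal θ t w.1 w.2 s')) := by
      refine StronglyMeasurable.integral_prod_right (f := fun (w : S × Vec q) (s' : S) =>
        M.value f θ n (t + 1) s' (M.nextGoal θ t w.1 w.2 s') •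
          M.dp w.1 (M.polW w.1 w.2) s') ?_
      refine StronglyMeasurable.smul ((hM.measurable_value hθ hf n (t + 1)).comp
          (hM.measurable_nextGoal_pair hθ t)).stronglyMeasurable ?_
      exact (hM.measurable_dp.comp ((measurable_fst.comp measurable_fst).prodMk
          ((hM.polW_meas.comp measurable_fst).prodMk measurable_snd))).stronglyMeasurable
    exact (continuous_fst.clm_comp continuous_snd : Continuous fun w :
      (Vec m →L[ℝ] ℝ) × (Vec q →L[ℝ] Vec m) => w.1.comp w.2).comp_stronglyMeasurable
        (h1.prodMk hM.measurable_dpolW.stronglyMeasurable)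

theorem stronglyMeasurable_dvalue (hM : M.Regular Θ) (hθ : θ ∈ Θ)
    (hf : M.IsReward f R K) (n : ℕ) : ∀ t,
    StronglyMeasurable fun w : S × Vec q => M.dvalue f θ n t w.1 w.2 := by
  have := hM.sigmaFinite
  have hsnd : Continuous fun T : Vec q →L[ℝ] ℝ =>
      T.comp (ContinuousLinearMap.snd ℝ (Vec d) (Vec q)) := continuous_id.clm_comp_const _
  induction n with
  | zero => exact fun t =>
      hsnd.comp_stronglyMeasurable (hM.stronglyMeasurable_immediateDeriv hθ hf 0 t)
  | succ n ih =>
    intro t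
    refine (hsnd.comp_stronglyMeasurable
      (hM.stronglyMeasurable_immediateDeriv hθ hf (n + 1) t)).add ?_
    refine StronglyMeasurable.integral_prod_right (f := fun (w : S × Vec q) (s' : S) =>
      M.p w.1 (M.polW w.1 w.2) s' •
        (M.dvalue f θ n (t + 1) s' (M.nextGoal θ t w.1 w.2 s')).comp
          ((ContinuousLinearMap.fst ℝ _ _).prod (M.dnextPair θ t w.1 w.2 s'))) ?_
    have h1 : Measurable fun p : (S × Vec q) × S => (p.1.1, p.1.2, p.2) := by fun_prop
    refine StronglyMeasurable.smul (hM.measurable_policy_dens.comp h1).stronglyMeasurable ?_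
    have h2 : Continuous fun w : (Vec d × Vec q →L[ℝ] ℝ) × (Vec d × Vec q →L[ℝ] Vec q) =>
        w.1.comp ((ContinuousLinearMap.fst ℝ _ _).prod w.2) :=
      continuous_fst.clm_comp ((ContinuousLinearMap.prodL ℝ).continuous.comp
        (continuous_const.prodMk continuous_snd))
    exact h2.comp_stronglyMeasurable (((ih (t + 1)).comp_measurable
      (hM.measurable_nextGoal_pair hθ t)).prodMk
      ((hM.measurable_dnextPair hθ t).comp h1).stronglyMeasurable)

/-- The bound does not depend on the horizon, because conditional expectations of the reward never
exceed R. The term K covers a goal that enters the reward directly, and R * L * L covers its effect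
through the action on the transition density. -/
theorem norm_immediateDeriv_le (hM : M.Regular Θ) (hL : M.DerivBound Θ L) (hθ : θ ∈ Θ)
    (hf : M.IsReward f R K) (n t : ℕ) (s : S) {g : Vec q} (hg : g ∈ M.G) :
    ‖M.immediateDeriv f θ n t s g‖ ≤ K + R * L * L := by
  have hL0 : 0 ≤ L := zero_le_one.trans hL.one_le
  have hR0 := hf.R_nonneg
  have hK0 := hf.L_nonneg
  cases n with
  | zero => exact (hf.fderiv_le s g hg).trans (le_add_of_nonneg_right (by positivity))
  | succ n =>
    refine le_trans (ContinuousLinearMap.opNorm_comp_le _ _) (le_add_of_nonneg_of_le hK0 ?_)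
    refine mul_le_mul (hM.norm_actDeriv_le hL s (hM.polW_mem s g hg) hR0 fun s' =>
      hM.abs_value_le hθ hf _ _ _ (hM.nextGoal_mem hθ t s hg s')) (hL.polW_le s g hg)
      (norm_nonneg _) (by positivity)

theorem pow_phase_le (hM : M.Regular Θ) (hL : M.DerivBound Θ L) (t : ℕ) :
    L ^ (1 + t % M.k) ≤ L ^ M.k :=
  pow_le_pow_right₀ hL.one_le (by have := Nat.mod_lt t hM.k_pos; omega)

theorem integrable_transport_dvalue (hM : M.Regular Θ) (hL : M.DerivBound Θ L) (hθ : θ ∈ Θ)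
    (hf : M.IsReward f R K) {n t : ℕ} {B : ℝ} (s : S) {g : Vec q} (hg : g ∈ M.G)
    (hB : ∀ s', ∀ g' ∈ M.G, ‖M.dvalue f θ n (t + 1) s' g'‖ ≤ B) :
    Integrable (fun s' => M.p s (M.polW s g) s' •
        (M.dvalue f θ n (t + 1) s' (M.nextGoal θ t s g s')).comp
          ((ContinuousLinearMap.fst ℝ _ _).prod (M.dnextPair θ t s g s'))) M.vol := by
  refine (hM.isMarkov_goalChain hθ).integrable_dens_smul (t := t) hg s ?_ (R := B * L) fun s' => ?_
  · have h2 : Continuous fun w : (Vec d × Vec q →L[ℝ] ℝ) × (Vec d × Vec q →L[ℝ] Vec q) =>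
        w.1.comp ((ContinuousLinearMap.fst ℝ _ _).prod w.2) :=
      continuous_fst.clm_comp ((ContinuousLinearMap.prodL ℝ).continuous.comp
        (continuous_const.prodMk continuous_snd))
    exact (h2.comp_stronglyMeasurable (((hM.stronglyMeasurable_dvalue hθ hf n
      (t + 1)).comp_measurable ((hM.measurable_nextGoal_pair hθ t).comp
        (measurable_prodMk_left (x := (s, g))))).prodMk
      ((hM.measurable_dnextPair hθ t).comp (by fun_prop :
        Measurable fun s' : S => (s, g, s'))).stronglyMeasurable)).aestronglyMeasurable
  · have hg' := hM.nextGoal_mem hθ t s hg s'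
    exact (ContinuousLinearMap.opNorm_comp_le _ _).trans (mul_le_mul (hB s' _ hg')
      (hL.norm_fst_prod_dnextPair_le hθ t s hg s') (norm_nonneg _) ((norm_nonneg _).trans (hB s' _ hg')))

/-- The growth in the horizon is linear because transport preserves the cone of tangent vectors with
‖v.1‖ ≤ c and ‖v.2‖ ≤ L ^ (1 + t % k) * c. Inside it, each step adds one immediate effect of size at
most (K + R * L * L) * L ^ k * c, and averaging over the next state does not enlarge the rest. The
cone estimate must carry the induction: an operator norm bound alone would lose a factor L at every
step. -/
theorem dvalue_bounds (hM : M.Regular Θ) (hL : M.DerivBound Θ L) (hθ : θ ∈ Θ)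
    (hf : M.IsReward f R K) (n : ℕ) : ∀ (t : ℕ) (s : S), ∀ g ∈ M.G,
    (∀ (c : ℝ) (v : Vec d × Vec q), ‖v.1‖ ≤ c → ‖v.2‖ ≤ L ^ (1 + t % M.k) * c →
      ‖M.dvalue f θ n t s g v‖ ≤ (n + 1) * ((K + R * L * L) * L ^ M.k) * c) ∧
    ‖M.dvalue f θ n t s g‖ ≤ (n + 1) * ((K + R * L * L) * L ^ M.k) := by
  have hL0 : 0 ≤ L := zero_le_one.trans hL.one_le
  have hR0 := hf.R_nonneg
  have hK0 := hf.L_nonneg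
  have hnorm : ∀ (t : ℕ) (s : S), ∀ g ∈ M.G,
      (∀ (c : ℝ) (v : Vec d × Vec q), ‖v.1‖ ≤ c → ‖v.2‖ ≤ L ^ (1 + t % M.k) * c →
      ‖M.dvalue f θ n t s g v‖ ≤ (n + 1) * ((K + R * L * L) * L ^ M.k) * c) →
      ‖M.dvalue f θ n t s g‖ ≤ (n + 1) * ((K + R * L * L) * L ^ M.k) := fun t s g _ h =>
    -- Since L ≥ 1, every vector lies in the cone with c = ‖v‖.
    ContinuousLinearMap.opNorm_le_bound _ (by positivity) fun v => h ‖v‖ v (norm_fst_le v)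
      ((norm_snd_le v).trans (le_mul_of_one_le_left (norm_nonneg _) (one_le_pow₀ hL.one_le)))
  suffices h : ∀ (t : ℕ) (s : S), ∀ g ∈ M.G, ∀ (c : ℝ) (v : Vec d × Vec q), ‖v.1‖ ≤ c →
      ‖v.2‖ ≤ L ^ (1 + t % M.k) * c →
      ‖M.dvalue f θ n t s g v‖ ≤ (n + 1) * ((K + R * L * L) * L ^ M.k) * c from
    fun t s g hg => ⟨h t s g hg, hnorm t s g hg (h t s g hg)⟩
  have himm : ∀ (i t : ℕ) (s : S), ∀ g ∈ M.G, ∀ (c : ℝ) (v : Vec d × Vec q), ‖v.1‖ ≤ c →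
      ‖v.2‖ ≤ L ^ (1 + t % M.k) * c →
      ‖M.immediateDeriv f θ i t s g v.2‖ ≤ (K + R * L * L) * L ^ M.k * c := by
    intro i t s g hg c v hv1 hv2
    have hc : 0 ≤ c := (norm_nonneg _).trans hv1
    refine (ContinuousLinearMap.le_of_opNorm_le _
      (hM.norm_immediateDeriv_le hL hθ hf i t s hg) _).trans ?_
    rw [mul_assoc (K + R * L * L)]
    exact mul_le_mul_of_nonneg_left (hv2.trans (mul_le_mul_of_nonneg_right
      (hM.pow_phase_le hL t) hc)) (by positivity)
  clear hnorm
  induction n with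
  | zero =>
    intro t s g hg c v hv1 hv2
    exact (show ‖M.dvalue f θ 0 t s g v‖ ≤ _ from himm 0 t s g hg c v hv1 hv2).trans_eq (by simp)
  | succ n ih =>
    intro t s g hg c v hv1 hv2
    -- The operator norm bound at the previous horizon gives the integrability needed to evaluate
    -- the integral of operators at v.
    have hB : ∀ s', ∀ g' ∈ M.G, ‖M.dvalue f θ n (t + 1) s' g'‖ ≤
        (n + 1) * ((K + R * L * L) * L ^ M.k) := fun s' g' hg' =>
      ContinuousLinearMap.opNorm_le_bound _ (by positivity) fun v => ih (t + 1) s' g' hg' ‖v‖ v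
        (norm_fst_le v) ((norm_snd_le v).trans (le_mul_of_one_le_left (norm_nonneg _)
          (one_le_pow₀ hL.one_le)))
    rw [dvalue, add_apply,
      ContinuousLinearMap.integral_apply (hM.integrable_transport_dvalue hL hθ hf s hg hB)]
    have h1 := himm (n + 1) t s g hg c v hv1 hv2
    have h2 := (hM.isMarkov_goalChain hθ).norm_integral_dens_smul_le (t := t) hg s
      (F := fun s' => (M.dvalue f θ n (t + 1) s' (M.nextGoal θ t s g s'))
        (v.1, M.dnextPair θ t s g s' v)) (R := (n + 1) * ((K + R * L * L) * L ^ M.k) * c)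
      fun s' => ih (t + 1) s' _ (hM.nextGoal_mem hθ t s hg s') c _ hv1
        (hM.norm_dnextPair_le hL hθ t s hg s' hv1 hv2)
    refine (norm_add_le_of_le h1 h2).trans_eq ?_
    push_cast
    ring

theorem norm_dvalue_le (hM : M.Regular Θ) (hL : M.DerivBound Θ L) (hθ : θ ∈ Θ)
    (hf : M.IsReward f R K) (n t : ℕ) (s : S) {g : Vec q} (hg : g ∈ M.G) :
    ‖M.dvalue f θ n t s g‖ ≤ (n + 1) * ((K + R * L * L) * L ^ M.k) :=
  (hM.dvalue_bounds hL hθ hf n t s g hg).2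

theorem hasFDerivAt_nextGoal (hM : M.Regular Θ) (hθ : θ ∈ Θ) (t : ℕ) (s : S)
    {g : Vec q} (hg : g ∈ M.G) (s' : S) :
    HasFDerivAt (fun z : Vec d × Vec q => M.nextGoal z.1 t s z.2 s') (M.dnextPair θ t s g s')
      (θ, g) := by
  have h1 : HasFDerivAt (fun z : Vec d × Vec q => z.1) (ContinuousLinearMap.fst ℝ _ _) (θ, g) :=
    hasFDerivAt_fst
  have h2 : HasFDerivAt (fun z : Vec d × Vec q => z.2) (ContinuousLinearMap.snd ℝ _ _) (θ, g) :=
    hasFDerivAt_snd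
  unfold nextGoal dnextPair
  split_ifs
  · exact (hM.hasFDerivAt_polM hθ s').comp (θ, g) h1
  · exact (hM.hasFDerivAt_h s hg s').comp (θ, g) h2

/-- The induction needs joint differentiability in (θ, g), at all parameters and goals: after one
step both arguments of the next value move together. The integrand is a product of the density,
which sees only the goal through the action, and the next value, and is differentiated under the
integral sign. -/
theorem hasFDerivAt_value (hM : M.Regular Θ) (hL : M.DerivBound Θ L)
    (hf : M.IsReward f R K) (n : ℕ) : ∀ (t : ℕ), ∀ θ ∈ Θ, ∀ (s : S), ∀ g ∈ M.G,
    HasFDerivAt (fun z : Vec d × Vec q => M.value f z.1 n t s z.2) (M.dvalue f θ n t s g)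
      (θ, g) := by
  have hL0 : 0 ≤ L := zero_le_one.trans hL.one_le
  have hR0 := hf.R_nonneg
  have hK0 := hf.L_nonneg
  induction n with
  | zero =>
    intro t θ hθ s g hg
    have h1 : HasFDerivAt (f s) (fderivOn M.G (f s) g) g := by
      rw [fderivOn_of_mem hg]
      exact (hf.diff s g hg).hasFDerivAt
    exact h1.comp (θ, g) hasFDerivAt_snd
  | succ n ih =>
    intro t θ hθ s g hg
    have ha := hM.polW_mem s g hg
    obtain ⟨U, hU, hUA, b, c, hb, hc, hbc⟩ := hM.exists_dominating s ha
    -- On N the action stays in the neighbourhood U where the density and its gradient are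
    -- dominated.
    set N : Set (Vec d × Vec q) := Θ ×ˢ (M.G ∩ M.polW s ⁻¹' U) with hN
    have hN0 : N ∈ 𝓝 (θ, g) := prod_mem_nhds (hM.isOpen_param.mem_nhds hθ)
      (inter_mem (hM.isOpen_G.mem_nhds hg) ((hM.polW_diff s g hg).continuousAt hU))
    set B : ℝ := (n + 1) * ((K + R * L * L) * L ^ M.k) with hB
    have hB0 : 0 ≤ B := by positivity
    have hpm : Measurable (M.p s (M.polW s g)) := hM.p_meas.comp (by fun_prop :
      Measurable fun s' : S => (s, M.polW s g, s'))
    have hder : ∀ z ∈ N, ∀ s', HasFDerivAt (fun z : Vec d × Vec q =>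
        M.p s (M.polW s z.2) s' * M.value f z.1 n (t + 1) s' (M.nextGoal z.1 t s z.2 s'))
        (M.p s (M.polW s z.2) s' •
          (M.dvalue f z.1 n (t + 1) s' (M.nextGoal z.1 t s z.2 s')).comp
            ((ContinuousLinearMap.fst ℝ _ _).prod (M.dnextPair z.1 t s z.2 s')) +
          M.value f z.1 n (t + 1) s' (M.nextGoal z.1 t s z.2 s') •
            ((M.dp s (M.polW s z.2) s').comp ((M.dpolW s z.2).comp
              (ContinuousLinearMap.snd ℝ _ _)))) z := by
      rintro ⟨θ', g'⟩ ⟨hθ', hg', hgU⟩ s'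
      refine HasFDerivAt.mul ?_ ?_
      · exact (hM.hasFDerivAt_p s (hUA hgU) s').comp (θ', g')
          ((hM.hasFDerivAt_polW s hg').comp (θ', g') hasFDerivAt_snd)
      · exact (ih (t + 1) θ' hθ' s' _ (hM.nextGoal_mem hθ' t s hg' s')).comp (θ', g')
          (hasFDerivAt_fst.prodMk (hM.hasFDerivAt_nextGoal hθ' t s hg' s'))
    have hnv : ∀ s', |M.value f θ n (t + 1) s' (M.nextGoal θ t s g s')| ≤ R := fun s' =>
      hM.abs_value_le hθ hf n (t + 1) s' (hM.nextGoal_mem hθ t s hg s')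
    have hvm := (hM.measurable_next_value hθ hf n t s g).aestronglyMeasurable (μ := M.vol)
    have hi1 := hM.integrable_transport_dvalue hL hθ hf s hg (n := n) (t := t) (B := B)
      fun s' g' hg' => hM.norm_dvalue_le hL hθ hf n (t + 1) s' hg'
    have hi2 := integral_clm_comp (hM.integrable_smul_dp s ha hvm hnv) ((M.dpolW s g).comp
      (ContinuousLinearMap.snd ℝ (Vec d) (Vec q)))
    simp only [ContinuousLinearMap.smul_comp] at hi2
    -- The two summands of the bound dominate the two terms of the product rule: the density times
    -- the derivative of the next value, and the next value times the derivative of the density.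
    have key := hasFDerivAt_integral_of_dominated_of_fderiv_le (μ := M.vol) (x₀ := (θ, g))
      (bound := fun s' => c s' * (B * L) + R * (b s' * L)) hN0 ?_ ?_ ?_
      (ae_of_all _ fun s' z hz => ?_) ?_ (ae_of_all _ fun s' z hz => hder z hz s')
    · refine key.congr_fderiv ?_
      rw [integral_add hi1 hi2.1, hi2.2]
      exact add_comm _ _
    · filter_upwards [hN0] with z hz
      exact ((hM.p_meas.comp (by fun_prop : Measurable fun s' : S => (s, M.polW s z.2, s'))).mul
        (hM.measurable_next_value hz.1 hf n t s z.2)).aestronglyMeasurable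
    · exact ((hM.isMarkov_goalChain hθ).integrable_dens_smul (t := t) hg s hvm hnv)
    · exact hi1.1.add hi2.1.1
    · obtain ⟨hθ', hg', hgU⟩ := hz
      have hb' := hbc _ hgU s'
      have hb0 : 0 ≤ b s' := (norm_nonneg _).trans hb'.1
      have hc0 : 0 ≤ c s' := (norm_nonneg _).trans hb'.2
      have hgn := hM.nextGoal_mem hθ' t s hg' s'
      refine norm_add_le_of_le ?_ ?_
      · rw [norm_smul]
        refine mul_le_mul hb'.2 ?_ (norm_nonneg _) hc0
        exact (ContinuousLinearMap.opNorm_comp_le _ _).trans (mul_le_mul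
          (hM.norm_dvalue_le hL hθ' hf n (t + 1) s' hgn)
          (hL.norm_fst_prod_dnextPair_le hθ' t s hg' s') (norm_nonneg _) hB0)
      · rw [norm_smul]
        refine mul_le_mul (hM.abs_value_le hθ' hf n (t + 1) s' hgn) ?_ (norm_nonneg _) hR0
        refine (ContinuousLinearMap.opNorm_comp_le _ _).trans
          (mul_le_mul hb'.1 ?_ (norm_nonneg _) hb0)
        refine (ContinuousLinearMap.opNorm_comp_le _ _).trans ?_
        exact (mul_le_mul (hL.polW_le s z.2 hg') (ContinuousLinearMap.norm_snd_le ℝ _ _)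
          (norm_nonneg _) hL0).trans_eq (mul_one L)
    · exact (hc.mul_const _).add ((hb.mul_const L).const_mul R)

end Regular

end HRLModel

/-! ### Discounted series with finite or infinite horizon -/

namespace HRLModel

variable {S V W : Type*} [MeasurableSpace S] {m q d : ℕ}
  [NormedAddCommGroup V] [NormedSpace ℝ V] [NormedAddCommGroup W] [NormedSpace ℝ W]
  {M : HRLModel S m q d} {Θ : Set (Vec d)} {θ : Vec d} {N : ℕ∞} {C : ℝ}

section Discounted

theorem discounted_of_le {t : ℕ} (h : (t : ℕ∞) ≤ N) (u : ℕ → V) :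
    M.discounted N u t = M.γ ^ t • u t := if_pos h

theorem discounted_of_not_le {t : ℕ} (h : ¬ (t : ℕ∞) ≤ N) (u : ℕ → V) :
    M.discounted N u t = 0 := if_neg h

theorem discounted_congr {u v : ℕ → V} (h : ∀ t : ℕ, (t : ℕ∞) ≤ N → u t = v t) :
    M.discounted N u = M.discounted N v := by
  funext t
  by_cases ht : (t : ℕ∞) ≤ N
  · rw [discounted_of_le ht, discounted_of_le ht, h t ht]
  · rw [discounted_of_not_le ht, discounted_of_not_le ht]

theorem map_discounted (T : V →L[ℝ] W) (u : ℕ → V) (t : ℕ) :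
    T (M.discounted N u t) = M.discounted N (fun t => T (u t)) t := by
  by_cases ht : (t : ℕ∞) ≤ N
  · rw [discounted_of_le ht, discounted_of_le ht, map_smul]
  · rw [discounted_of_not_le ht, discounted_of_not_le ht, map_zero]

theorem norm_discounted_le (hγ : 0 ≤ M.γ) {u : ℕ → V} {v : ℕ → ℝ} (h : ∀ t, ‖u t‖ ≤ v t) (t : ℕ) :
    ‖M.discounted N u t‖ ≤ M.discounted N v t := by
  by_cases ht : (t : ℕ∞) ≤ N
  · rw [discounted_of_le ht, discounted_of_le ht, norm_smul, Real.norm_of_nonneg (pow_nonneg hγ t)]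
    exact mul_le_mul_of_nonneg_left (h t) (pow_nonneg hγ t)
  · rw [discounted_of_not_le ht, discounted_of_not_le ht, norm_zero]

theorem _root_.ENat.natCast_add_le_iff {N : ℕ∞} {i j : ℕ} (h : (j : ℕ∞) ≤ N) :
    ((i + j : ℕ) : ℕ∞) ≤ N ↔ (i : ℕ∞) ≤ N - j := by
  induction N using ENat.recTopCoe with
  | top => simp
  | coe N =>
    norm_cast at h ⊢
    omega

theorem summable_geometric_mul_succ {γ : ℝ} (hγ : 0 ≤ γ) (h : γ < 1) :
    Summable fun n : ℕ => γ ^ n * ((n : ℝ) + 1) := by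
  have hn : ‖γ‖ < 1 := by rwa [Real.norm_of_nonneg hγ]
  have h1 := (summable_pow_mul_geometric_of_norm_lt_one 1 hn).add
    (summable_geometric_of_lt_one hγ h)
  exact h1.congr fun n => by ring

/-- The linear weight matches the growth of derivatives in the horizon. For γ < 1 the geometric
factor wins; for a finite horizon almost all terms vanish. -/
theorem summable_discounted_linear (hγ : 0 ≤ M.γ) (hN : M.γ < 1 ∨ N ≠ ⊤) (C : ℝ) :
    Summable (M.discounted N fun n => C * ((n : ℝ) + 1)) := by
  rcases hN with h | h
  · have h1 := ((summable_geometric_mul_succ hγ h).mul_left |C|)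
    refine Summable.of_norm_bounded h1 fun n => ?_
    refine (norm_discounted_le hγ (v := fun n => |C| * ((n : ℝ) + 1)) (fun t => ?_) n).trans ?_
    · rw [norm_mul, Real.norm_eq_abs, Real.norm_of_nonneg (by positivity)]
    · by_cases ht : (n : ℕ∞) ≤ N
      · rw [discounted_of_le ht, smul_eq_mul]
        exact le_of_eq (by ring)
      · rw [discounted_of_not_le ht]
        positivity
  · lift N to ℕ using h
    refine summable_of_ne_finset_zero (s := Finset.range (N + 1)) fun n hn => ?_
    refine discounted_of_not_le (fun h => hn ?_) _
    rw [Finset.mem_range]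
    exact Nat.lt_succ_of_le (by exact_mod_cast h)

theorem summable_discounted [CompleteSpace V] (hγ : 0 ≤ M.γ) (hN : M.γ < 1 ∨ N ≠ ⊤) {u : ℕ → V}
    (h : ∀ n : ℕ, ‖u n‖ ≤ C * ((n : ℝ) + 1)) : Summable (M.discounted N u) :=
  Summable.of_norm_bounded (summable_discounted_linear hγ hN C) (norm_discounted_le hγ h)

theorem summable_discounted_of_norm_le [CompleteSpace V] (hγ : 0 ≤ M.γ) (hN : M.γ < 1 ∨ N ≠ ⊤)
    {u : ℕ → V} (h : ∀ n : ℕ, ‖u n‖ ≤ C) : Summable (M.discounted N u) :=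
  summable_discounted hγ hN (C := C) fun n =>
    (h n).trans (le_mul_of_one_le_right ((norm_nonneg _).trans (h n)) (by
      have : (0 : ℝ) ≤ n := n.cast_nonneg
      linarith))

theorem norm_tsum_discounted_le (hγ : 0 ≤ M.γ) (hN : M.γ < 1 ∨ N ≠ ⊤)
    {u : ℕ → V} (h : ∀ n : ℕ, ‖u n‖ ≤ C * ((n : ℝ) + 1)) :
    ‖∑' n, M.discounted N u n‖ ≤ ∑' n, M.discounted N (fun n => C * ((n : ℝ) + 1)) n :=
  tsum_of_norm_bounded (summable_discounted_linear hγ hN C).hasSum (norm_discounted_le hγ h)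

/-- The case N = 0 must be excluded: truncated subtraction gives N - 1 = 0, and the right-hand side
would keep a term that the left-hand side cuts off. -/
theorem discounted_succ (hN : N ≠ 0) (u : ℕ → V) (n : ℕ) :
    M.discounted N u (n + 1) = M.γ • M.discounted (N - 1) (fun n => u (n + 1)) n := by
  have hiff : ((n + 1 : ℕ) : ℕ∞) ≤ N ↔ (n : ℕ∞) ≤ N - 1 := by
    simpa using ENat.natCast_add_le_iff (N := N) (i := n) (j := 1)
      (by simpa using Order.one_le_iff_ne_zero.2 hN)
  by_cases h : (n : ℕ∞) ≤ N - 1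
  · rw [discounted_of_le h, discounted_of_le (hiff.2 h), pow_succ', mul_smul]
  · rw [discounted_of_not_le h, discounted_of_not_le (mt hiff.1 h), smul_zero]

theorem tsum_discounted_eq_zero_add (u : ℕ → V) (h : Summable (M.discounted N u)) :
    ∑' n, M.discounted N u n = u 0 +
      open Classical in if N = 0 then 0
      else M.γ • ∑' n, M.discounted (N - 1) (fun n => u (n + 1)) n := by
  rw [h.tsum_eq_zero_add, discounted_of_le (by simp), pow_zero, one_smul]
  congr 1
  split_ifs with hN
  · subst hN
    convert tsum_zero with n
    exact discounted_of_not_le (by simp) _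
  · simp only [discounted_succ hN]
    exact tsum_const_smul'' _

theorem hasFDerivAt_tsum_discounted {n : ℕ} [CompleteSpace V] (hγ : 0 ≤ M.γ)
    (hN : M.γ < 1 ∨ N ≠ ⊤) {f : ℕ → Vec n → V} {f' : ℕ → Vec n → Vec n →L[ℝ] V} {O : Set (Vec n)}
    (hO : IsOpen O) (hf : ∀ i, ∀ y ∈ O, HasFDerivAt (f i) (f' i y) y)
    (hf' : ∀ i, ∀ y ∈ O, ‖f' i y‖ ≤ C * ((i : ℝ) + 1)) {x : Vec n} (hx : x ∈ O)
    (hs : Summable (M.discounted N fun i => f i x)) :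
    HasFDerivAt (fun y => ∑' i, M.discounted N (fun i => f i y) i)
      (∑' i, M.discounted N (fun i => f' i x) i) x := by
  obtain ⟨ε, hε, hball⟩ := Metric.isOpen_iff.1 hO x hx
  refine hasFDerivAt_tsum_of_isPreconnected (f := fun i y => M.discounted N (fun i => f i y) i)
    (f' := fun i y => M.discounted N (fun i => f' i y) i)
    (summable_discounted_linear hγ hN C) Metric.isOpen_ball (convex_ball x ε).isPreconnected
    (fun i y hy => ?_) (fun i y hy => ?_) (Metric.mem_ball_self hε) hs (Metric.mem_ball_self hε)
  · by_cases h : (i : ℕ∞) ≤ N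
    · simp only [discounted_of_le h]
      exact (hf i y (hball hy)).const_smul _
    · simp only [discounted_of_not_le h]
      exact hasFDerivAt_const _ _
  · by_cases h : (i : ℕ∞) ≤ N
    · rw [discounted_of_le h, discounted_of_le h, norm_smul, Real.norm_of_nonneg (pow_nonneg hγ i)]
      exact mul_le_mul_of_nonneg_left (hf' i y (hball hy)) (pow_nonneg hγ i)
    · rw [discounted_of_not_le h, discounted_of_not_le h, norm_zero]

theorem ne_top_sub (h : M.γ < 1 ∨ N ≠ ⊤) (t : ℕ∞) : M.γ < 1 ∨ N - t ≠ ⊤ :=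
  h.imp id fun h => ne_top_of_le_ne_top h tsub_le_self

/-- Rearrangement of a discounted double series along its antidiagonals. -/
theorem tsum_discounted_antidiagonal [CompleteSpace V] (hγ : 0 ≤ M.γ) (hN : M.γ < 1 ∨ N ≠ ⊤)
    {T : ℕ → ℕ → V} (hT : ∀ i j : ℕ, ‖T i j‖ ≤ C * ((i : ℝ) + 1)) :
    Summable (M.discounted N fun j => ∑' i, M.discounted (N - j) (fun i => T i j) i) ∧
    ∑' n, M.discounted N (fun n => ∑ j ∈ Finset.range (n + 1), T (n - j) j) n =
      ∑' j, M.discounted N (fun j => ∑' i, M.discounted (N - j) (fun i => T i j) i) j := by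
  classical
  have hC : 0 ≤ C := by simpa using (norm_nonneg _).trans (hT 0 0)
  -- The first index is the time j of the cause, the second the delay i until the reward; the
  -- cut-off acts on the sum j + i.
  set g : ℕ × ℕ → V := fun w =>
    if ((w.1 + w.2 : ℕ) : ℕ∞) ≤ N then M.γ ^ (w.1 + w.2) • T w.2 w.1 else 0 with hg
  have hgs : Summable g := by
    rcases hN with h | h
    · have h1 : Summable fun w : ℕ × ℕ => M.γ ^ w.1 * (C * (M.γ ^ w.2 * ((w.2 : ℝ) + 1))) :=
        Summable.mul_of_nonneg (summable_geometric_of_lt_one hγ h)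
          ((summable_geometric_mul_succ hγ h).mul_left C) (fun n => pow_nonneg hγ n)
          (fun n => by positivity)
      refine Summable.of_norm_bounded h1 fun w => ?_
      simp only [hg]
      split_ifs
      · rw [norm_smul, Real.norm_of_nonneg (pow_nonneg hγ _)]
        refine (mul_le_mul_of_nonneg_left (hT w.2 w.1) (pow_nonneg hγ _)).trans_eq ?_
        ring
      · rw [norm_zero]
        positivity
    · lift N to ℕ using h
      refine summable_of_ne_finset_zero (s := Finset.range (N + 1) ×ˢ Finset.range (N + 1))
        fun w hw => if_neg fun h => hw ?_
      have : w.1 + w.2 ≤ N := by exact_mod_cast h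
      rw [Finset.mem_product, Finset.mem_range, Finset.mem_range]
      omega
  -- Summing over delays first: for j ≤ N the condition j + i ≤ N reads i ≤ N - j, which is the
  -- remaining horizon in the action values.
  have hrow : ∀ j, M.discounted N (fun j => ∑' i, M.discounted (N - j) (fun i => T i j) i) j =
      ∑' i, g (j, i) := by
    intro j
    by_cases hj : (j : ℕ∞) ≤ N
    · rw [discounted_of_le hj]
      have : ∀ i, g (j, i) = M.γ ^ j • M.discounted (N - j) (fun i => T i j) i := by
        intro i
        have hiff : ((j + i : ℕ) : ℕ∞) ≤ N ↔ (i : ℕ∞) ≤ N - j := by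
          rw [add_comm j i]
          exact ENat.natCast_add_le_iff hj
        by_cases hi : (i : ℕ∞) ≤ N - j
        · rw [discounted_of_le hi]
          simp only [hg, if_pos (hiff.2 hi), pow_add, mul_smul]
        · rw [discounted_of_not_le hi, smul_zero]
          exact if_neg (mt hiff.1 hi)
      simp only [this]
      exact (tsum_const_smul'' _).symm
    · rw [discounted_of_not_le hj]
      have : ∀ i, g (j, i) = 0 := fun i => if_neg fun h => hj (le_trans (by
        exact_mod_cast Nat.le_add_right j i) h)
      simp only [this, tsum_zero]
  have hdiag : ∀ n, M.discounted N (fun n => ∑ j ∈ Finset.range (n + 1), T (n - j) j) n =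
      ∑ w ∈ Finset.HasAntidiagonal.antidiagonal n, g w := by
    intro n
    have : ∀ w ∈ Finset.HasAntidiagonal.antidiagonal n,
        g w = if (n : ℕ∞) ≤ N then M.γ ^ n • T w.2 w.1 else 0 := fun w hw => by
      simp only [hg, Finset.HasAntidiagonal.mem_antidiagonal.1 hw]
    rw [Finset.sum_congr rfl this]
    by_cases hn : (n : ℕ∞) ≤ N
    · rw [discounted_of_le hn]
      simp only [if_pos hn]
      rw [← Finset.smul_sum, Finset.Nat.sum_antidiagonal_eq_sum_range_succ (fun j i => T i j)]
    · rw [discounted_of_not_le hn]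
      simp only [if_neg hn, Finset.sum_const_zero]
  have hfun : (M.discounted N fun j => ∑' i, M.discounted (N - j) (fun i => T i j) i) =
      fun j => ∑' i, g (j, i) := funext hrow
  refine ⟨hfun ▸ hgs.prod, ?_⟩
  simp only [hrow, hdiag]
  rw [← hgs.tsum_prod, ← Finset.HasAntidiagonal.sigmaAntidiagonalEquivProd.tsum_eq g]
  conv_lhs => congr; ext; rw [← Finset.sum_finset_coe, ← tsum_fintype (L := .unconditional _)]
  exact ((Finset.HasAntidiagonal.sigmaAntidiagonalEquivProd.summable_iff.2 hgs).tsum_sigma'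
    fun n => (hasSum_fintype _).summable).symm

end Discounted

/-! ### Exchanging expectations and discounted series -/

section Expectation

theorem Regular.integral_trajDensity (hM : M.Regular Θ) (hθ : θ ∈ Θ) (n : ℕ) :
    Integrable (fun x : Fin (n + 1) → S => M.trajDensity θ x) (Measure.pi fun _ => M.vol) ∧
      ∫ x : Fin (n + 1) → S, M.trajDensity θ x ∂(Measure.pi fun _ => M.vol) = 1 := by
  -- The total mass is the expectation of the constant reward 1.
  have hval : ∀ (n t : ℕ) (s : S), ∀ g ∈ M.G,
      (M.goalChain θ).val (fun _ _ => (1 : ℝ)) n t s g = 1 := by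
    intro n
    induction n with
    | zero => exact fun _ _ _ _ => rfl
    | succ n ih =>
      intro t s g hg
      rw [AuxChain.val]
      refine Eq.trans ?_ ((hM.isMarkov_goalChain hθ).dens_integral t s g hg)
      exact integral_congr_ae (ae_of_all _ fun s' => by
        simp only [ih (t + 1) s' _ ((hM.isMarkov_goalChain hθ).next_mem t s g hg s'), smul_eq_mul,
          mul_one])
  have h1 := hM.expectIntegrable hθ (F := fun _ _ => (1 : ℝ)) stronglyMeasurable_const
    (R := 1) (fun _ _ _ => by simp) n
  have h2 := hM.expect_eq hθ (F := fun _ _ => (1 : ℝ)) stronglyMeasurable_const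
    (R := 1) (fun _ _ _ => by simp) n
  simp only [ExpectIntegrable, expect, smul_eq_mul, mul_one] at h1 h2
  refine ⟨h1, h2.trans (Eq.trans ?_ hM.ρ₀_integral)⟩
  exact integral_congr_ae (ae_of_all _ fun s => by
    simp only [hval n 0 s _ (hM.polM_mem θ hθ s), mul_one])

theorem Regular.trajDensity_nonneg (hM : M.Regular Θ) (hθ : θ ∈ Θ) {n : ℕ} (x : Fin (n + 1) → S) :
    0 ≤ M.trajDensity θ x := by
  refine mul_nonneg (hM.ρ₀_nonneg _) ?_
  rw [← pathDens_goalChain]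
  exact (hM.isMarkov_goalChain hθ).pathDens_nonneg (t := 0) (hM.polM_mem θ hθ (x 0)) _ n

theorem Regular.integral_norm_trajDensity_smul_le (hM : M.Regular Θ) (hθ : θ ∈ Θ) {n : ℕ}
    {F : (ℕ → S) → V} (hF : ∀ x, ‖F x‖ ≤ C) :
    ∫ x : Fin (n + 1) → S, ‖M.trajDensity θ x • F (extend x)‖
      ∂(Measure.pi fun _ => M.vol) ≤ C := by
  refine (Real.le_norm_self _).trans ((norm_integral_le_of_norm_le
    ((hM.integral_trajDensity hθ n).1.mul_const C) (ae_of_all _ fun x => ?_)).trans_eq ?_)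
  · rw [norm_norm, norm_smul, Real.norm_of_nonneg (hM.trajDensity_nonneg hθ x)]
    exact mul_le_mul_of_nonneg_left (hF _) (hM.trajDensity_nonneg hθ x)
  · rw [integral_mul_const, (hM.integral_trajDensity hθ n).2, one_mul]

theorem Regular.norm_expect_le (hM : M.Regular Θ) (hθ : θ ∈ Θ) {n : ℕ}
    {F : (ℕ → S) → V} (hF : ∀ x, ‖F x‖ ≤ C) : ‖M.expect θ n F‖ ≤ C :=
  (norm_integral_le_integral_norm _).trans (hM.integral_norm_trajDensity_smul_le hθ hF)

theorem expect_clm_comp [CompleteSpace V] [CompleteSpace W] {n : ℕ} (T : V →L[ℝ] W)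
    {F : (ℕ → S) → V} (hF : M.ExpectIntegrable θ n F) :
    M.ExpectIntegrable θ n (fun x => T (F x)) ∧
      M.expect θ n (fun x => T (F x)) = T (M.expect θ n F) := by
  unfold ExpectIntegrable expect
  simp only [← map_smul]
  exact ⟨T.integrable_comp hF, T.integral_comp_comm hF⟩

theorem smul_discounted (c : ℝ) (u : ℕ → V) (t : ℕ) :
    c • M.discounted N u t = M.discounted N (fun t => c • u t) t :=
  map_discounted (c • ContinuousLinearMap.id ℝ V) u t

theorem integral_discounted {X : Type*} [MeasurableSpace X] {μ : Measure X} (u : ℕ → X → V)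
    (t : ℕ) : ∫ x, M.discounted N (fun t => u t x) t ∂μ =
      M.discounted N (fun t => ∫ x, u t x ∂μ) t := by
  by_cases ht : (t : ℕ∞) ≤ N
  · simp only [discounted_of_le ht, integral_smul]
  · simp only [discounted_of_not_le ht, integral_zero]

theorem hasSum_integral_discounted {X : Type*} [MeasurableSpace X] {μ : Measure X}
    [CompleteSpace V] (hγ : 0 ≤ M.γ) (hN : M.γ < 1 ∨ N ≠ ⊤) {u : ℕ → X → V}
    (hu : ∀ i, Integrable (u i) μ) (hC : ∀ i, ∫ x, ‖u i x‖ ∂μ ≤ C * ((i : ℝ) + 1)) :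
    HasSum (M.discounted N fun i => ∫ x, u i x ∂μ)
      (∫ x, ∑' i, M.discounted N (fun i => u i x) i ∂μ) := by
  have hi : ∀ i, Integrable (fun x => M.discounted N (fun i => u i x) i) μ := fun i => by
    by_cases h : (i : ℕ∞) ≤ N
    · simp only [discounted_of_le h]
      exact (hu i).smul _
    · simp only [discounted_of_not_le h]
      exact integrable_zero _ _ _
  have hs : Summable fun i => ∫ x, ‖M.discounted N (fun i => u i x) i‖ ∂μ := by
    refine Summable.of_nonneg_of_le (fun i => integral_nonneg fun x => norm_nonneg _) (fun i => ?_)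
      (summable_discounted_linear hγ hN C)
    by_cases h : (i : ℕ∞) ≤ N
    · simp only [discounted_of_le h, norm_smul, Real.norm_of_nonneg (pow_nonneg hγ i)]
      rw [integral_const_mul]
      exact mul_le_mul_of_nonneg_left (hC i) (pow_nonneg hγ i)
    · simp only [discounted_of_not_le h, norm_zero, integral_zero, le_refl]
  have := hasSum_integral_of_summable_integral_norm hi hs
  simpa only [integral_discounted] using this

theorem Regular.expect_tsum_discounted [CompleteSpace V] (hM : M.Regular Θ) (hθ : θ ∈ Θ)
    (hN : M.γ < 1 ∨ N ≠ ⊤) {n : ℕ} {F : ℕ → (ℕ → S) → V}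
    (hF : ∀ i, M.ExpectIntegrable θ n (F i)) (hC : ∀ (i : ℕ) x, ‖F i x‖ ≤ C * ((i : ℝ) + 1)) :
    M.expect θ n (fun x => ∑' i, M.discounted N (fun i => F i x) i) =
      ∑' i, M.discounted N (fun i => M.expect θ n (F i)) i := by
  have := hasSum_integral_discounted (M := M) hM.γ_pos.le hN hF
    fun i => hM.integral_norm_trajDensity_smul_le hθ (hC i)
  refine Eq.trans ?_ this.tsum_eq.symm
  refine integral_congr_ae (ae_of_all _ fun x => ?_)
  simp only [← smul_discounted]
  exact (tsum_const_smul'' _).symm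

end Expectation

end HRLModel

/-! ### The gradient of one expected reward as a sum over causes -/

namespace HRLModel

variable {S : Type*} [MeasurableSpace S] {m q d : ℕ}
  {M : HRLModel S m q d} {Θ : Set (Vec d)} {θ : Vec d} {N : ℕ∞} {L R K : ℝ} {f : S → Vec q → ℝ}

/-- The derivative of the expected reward at time `n` with respect to the parameter. -/
noncomputable def dexpect (M : HRLModel S m q d) (f : S → Vec q → ℝ) (n : ℕ) (θ : Vec d) :
    Vec d →L[ℝ] ℝ :=
  ∫ s, M.ρ₀ s • (M.dvalue f θ n 0 s (M.polM θ s)).comp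
    ((ContinuousLinearMap.id ℝ _).prod (M.dpolM θ s)) ∂M.vol

theorem continuous_comp_id_prod :
    Continuous fun w : (Vec d × Vec q →L[ℝ] ℝ) × (Vec d →L[ℝ] Vec q) =>
      w.1.comp ((ContinuousLinearMap.id ℝ (Vec d)).prod w.2) :=
  continuous_fst.clm_comp ((ContinuousLinearMap.prodL ℝ).continuous.comp
    (continuous_const.prodMk continuous_snd))

namespace Regular

theorem integral_ρ₀_mul_const (hM : M.Regular Θ) (C : ℝ) : ∫ s, M.ρ₀ s * C ∂M.vol = C := by
  rw [integral_mul_const, hM.ρ₀_integral, one_mul]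

theorem norm_comp_id_prod_dpolM_le (hM : M.Regular Θ) (hL : M.DerivBound Θ L)
    (hf : M.IsReward f R K) (hθ : θ ∈ Θ) (n : ℕ) (s : S) :
    ‖(M.dvalue f θ n 0 s (M.polM θ s)).comp
      ((ContinuousLinearMap.id ℝ _).prod (M.dpolM θ s))‖ ≤
        (n + 1) * ((K + R * L * L) * L ^ M.k) * L := by
  have hL0 : 0 ≤ L := zero_le_one.trans hL.one_le
  have h := hM.norm_dvalue_le hL hθ hf n 0 s (hM.polM_mem θ hθ s)
  refine (ContinuousLinearMap.opNorm_comp_le _ _).trans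
    (mul_le_mul h ?_ (norm_nonneg _) ((norm_nonneg _).trans h))
  refine ContinuousLinearMap.opNorm_le_bound _ hL0 fun v => max_le ?_ ?_
  · exact le_mul_of_one_le_left (norm_nonneg _) hL.one_le
  · exact ContinuousLinearMap.le_of_opNorm_le _ (hL.polM_le θ hθ s) v

theorem norm_ρ₀_smul_le (hM : M.Regular Θ) {V : Type*} [NormedAddCommGroup V] [NormedSpace ℝ V]
    {s : S} {v : V} {C : ℝ} (hv : ‖v‖ ≤ C) : ‖M.ρ₀ s • v‖ ≤ M.ρ₀ s * C := by
  rw [norm_smul, Real.norm_of_nonneg (hM.ρ₀_nonneg s)]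
  exact mul_le_mul_of_nonneg_left hv (hM.ρ₀_nonneg s)

theorem norm_dexpect_le (hM : M.Regular Θ) (hL : M.DerivBound Θ L) (hf : M.IsReward f R K)
    (hθ : θ ∈ Θ) (n : ℕ) : ‖M.dexpect f n θ‖ ≤ (n + 1) * ((K + R * L * L) * L ^ M.k) * L :=
  (norm_integral_le_of_norm_le (hM.integrable_ρ₀.mul_const _) (ae_of_all _ fun s =>
    hM.norm_ρ₀_smul_le (hM.norm_comp_id_prod_dpolM_le hL hf hθ n s))).trans_eq
      (hM.integral_ρ₀_mul_const _)

theorem expect_eq_value (hM : M.Regular Θ) (hf : M.IsReward f R K) (hθ : θ ∈ Θ) (n : ℕ) :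
    M.expect θ n (fun x => f (x n) (M.goal θ x n)) =
      ∫ s, M.ρ₀ s * M.value f θ n 0 s (M.polM θ s) ∂M.vol :=
  hM.expect_eq hθ hf.meas.stronglyMeasurable hf.le n

/-- The initial goal is itself chosen by the manager, so the value is differentiated along θ ↦ (θ,
π_m(s_0)). Its formula as an integral against the initial density is available only on the open set
`Θ`, which suffices locally. -/
theorem hasFDerivAt_expect (hM : M.Regular Θ) (hL : M.DerivBound Θ L) (hf : M.IsReward f R K)
    (hθ : θ ∈ Θ) (n : ℕ) :
    HasFDerivAt (fun θ' => M.expect θ' n (fun x => f (x n) (M.goal θ' x n)))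
      (M.dexpect f n θ) θ := by
  have hΘ := hM.isOpen_param.mem_nhds hθ
  have hvm : ∀ θ ∈ Θ, AEStronglyMeasurable
      (fun s => M.ρ₀ s * M.value f θ n 0 s (M.polM θ s)) M.vol := fun θ hθ =>
    (hM.ρ₀_meas.mul ((hM.measurable_value hθ hf n 0).comp
      (measurable_id.prodMk (hM.polM_meas θ hθ)))).aestronglyMeasurable
  have key : HasFDerivAt (fun θ' => ∫ s, M.ρ₀ s * M.value f θ' n 0 s (M.polM θ' s) ∂M.vol)
      (M.dexpect f n θ) θ := by
    refine hasFDerivAt_integral_of_dominated_of_fderiv_le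
      (bound := fun s => M.ρ₀ s * ((n + 1) * ((K + R * L * L) * L ^ M.k) * L))
      (F' := fun θ s => M.ρ₀ s • (M.dvalue f θ n 0 s (M.polM θ s)).comp
        ((ContinuousLinearMap.id ℝ _).prod (M.dpolM θ s))) hΘ ?_ ?_ ?_
      (ae_of_all _ fun s θ' hθ' =>
        hM.norm_ρ₀_smul_le (hM.norm_comp_id_prod_dpolM_le hL hf hθ' n s))
      (hM.integrable_ρ₀.mul_const _) (ae_of_all _ fun s θ' hθ' => ?_)
    · filter_upwards [hΘ] with θ' hθ' using hvm θ' hθ'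
    · refine (hM.integrable_ρ₀.mul_const R).mono' (hvm θ hθ) (ae_of_all _ fun s => ?_)
      exact hM.norm_ρ₀_smul_le (hM.abs_value_le hθ hf n 0 s (hM.polM_mem θ hθ s))
    · refine hM.ρ₀_meas.aestronglyMeasurable.smul ?_
      exact (continuous_comp_id_prod.comp_stronglyMeasurable
        (((hM.stronglyMeasurable_dvalue hθ hf n 0).comp_measurable
          (measurable_id.prodMk (hM.polM_meas θ hθ))).prodMk
          (hM.measurable_dpolM hθ).stronglyMeasurable)).aestronglyMeasurable
    · exact ((hM.hasFDerivAt_value hL hf n 0 θ' hθ' s _ (hM.polM_mem θ' hθ' s)).comp θ'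
        ((hasFDerivAt_id θ').prodMk (hM.hasFDerivAt_polM hθ' s))).const_mul _
  refine key.congr_of_eventuallyEq ?_
  filter_upwards [hΘ] with θ' hθ' using hM.expect_eq_value hf hθ' n

theorem norm_immediateDeriv_comp_le (hM : M.Regular Θ) (hL : M.DerivBound Θ L)
    (hf : M.IsReward f R K) (hθ : θ ∈ Θ) (i t : ℕ) (s : S)
    {z : Vec q × (Vec d →L[ℝ] Vec q)} (hz : z ∈ (M.jacobianChain θ L).dom t) :
    ‖(M.immediateDeriv f θ i t s z.1).comp z.2‖ ≤ (K + R * L * L) * L ^ M.k := by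
  have h := hM.norm_immediateDeriv_le hL hθ hf i t s hz.1
  exact (ContinuousLinearMap.opNorm_comp_le _ _).trans (mul_le_mul h
    (hz.2.trans (hM.pow_phase_le hL t)) (norm_nonneg _) ((norm_nonneg _).trans h))

theorem stronglyMeasurable_immediateDeriv_comp (hM : M.Regular Θ) (hf : M.IsReward f R K)
    (hθ : θ ∈ Θ) (i t : ℕ) :
    StronglyMeasurable fun w : S × (Vec q × (Vec d →L[ℝ] Vec q)) =>
      (M.immediateDeriv f θ i t w.1 w.2.1).comp w.2.2 := by
  have h : Continuous fun w : (Vec q →L[ℝ] ℝ) × (Vec d →L[ℝ] Vec q) => w.1.comp w.2 :=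
    continuous_fst.clm_comp continuous_snd
  refine h.comp_stronglyMeasurable (StronglyMeasurable.prodMk ?_ ?_)
  · exact (hM.stronglyMeasurable_immediateDeriv hθ hf i t).comp_measurable (by fun_prop :
      Measurable fun w : S × (Vec q × (Vec d →L[ℝ] Vec q)) => (w.1, w.2.1))
  · exact (measurable_snd.comp measurable_snd).stronglyMeasurable

/-- The policy gradient as a sum of the immediate effects of the goals of all times. -/
theorem dexpect_eq_sum_immediate (hM : M.Regular Θ) (hL : M.DerivBound Θ L)
    (hf : M.IsReward f R K) (hθ : θ ∈ Θ) (n : ℕ) :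
    M.dexpect f n θ = ∑ j ∈ Finset.range (n + 1), M.expect θ j fun x =>
      (M.immediateDeriv f θ (n - j) j (x j) (M.goal θ x j)).comp
        (fderiv ℝ (fun θ' => M.goal θ' x j) θ) := by
  have hJ := hM.isMarkov_jacobianChain hL hθ
  have hsrc := fun i t => hM.stronglyMeasurable_immediateDeriv_comp hf hθ i t
  have hB := hM.norm_immediateDeriv_comp_le hL hf hθ
  -- Restricting the derivative of the value to the directions (v, D v), with D the Jacobian carried
  -- by the chain, turns the transport of tangent vectors into the motion of the auxiliary variable.
  have hY := hJ.eq_sum_val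
    (Y := fun n t s z => (M.dvalue f θ n t s z.1).comp ((ContinuousLinearMap.id ℝ _).prod z.2))
    (src := fun i t s z => (M.immediateDeriv f θ i t s z.1).comp z.2)
    hsrc (fun i t => ⟨_, fun s z hz => hB i t s hz⟩) (fun t s z hz => rfl) ?_ n 0
  · have hz : Measurable fun s => (s, (M.polM θ s, M.dpolM θ s)) :=
      measurable_id.prodMk ((hM.polM_meas θ hθ).prodMk (hM.measurable_dpolM hθ))
    have h1 : ∀ s, M.ρ₀ s • (M.dvalue f θ n 0 s (M.polM θ s)).comp
        ((ContinuousLinearMap.id ℝ _).prod (M.dpolM θ s)) =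
        ∑ j ∈ Finset.range (n + 1), M.ρ₀ s • (M.jacobianChain θ L).val
          (fun s z => (M.immediateDeriv f θ (n - j) j s z.1).comp z.2) j 0 s
            (M.polM θ s, M.dpolM θ s) := fun s => by
      rw [← Finset.smul_sum]
      simpa only [zero_add] using congrArg (fun T => M.ρ₀ s • T)
        (hY s _ (hM.polM_mem_jacobianChain hL hθ s))
    unfold dexpect
    simp only [h1]
    rw [integral_finsetSum]
    · refine Finset.sum_congr rfl fun j _ => ?_
      exact (hM.expect_jacobian_eq hL hθ (hsrc (n - j) j)
        (fun s z hz => hB (n - j) j s hz)).symm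
    · intro j _
      refine hM.integrable_ρ₀.smul_bdd ((K + R * L * L) * L ^ M.k) ?_ (ae_of_all _ fun s => ?_)
      · exact ((hJ.stronglyMeasurable_val (hsrc (n - j) j) j 0).comp_measurable
          hz).aestronglyMeasurable
      · exact hJ.norm_val_le (t := 0) (fun s z hz => hB (n - j) j s (by simpa using hz)) s
          (hM.polM_mem_jacobianChain hL hθ s)
  · intro n t s z hz
    have hi := hM.integrable_transport_dvalue hL hθ hf s hz.1 (n := n) (t := t)
      fun s' g' hg' => hM.norm_dvalue_le hL hθ hf n (t + 1) s' hg'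
    rw [dvalue, ContinuousLinearMap.add_comp,
      ← (integral_clm_comp hi ((ContinuousLinearMap.id ℝ _).prod z.2)).2]
    congr 1
    refine integral_congr_ae (ae_of_all _ fun s' => ?_)
    ext v
    change M.p s (M.polW s z.1) s' * M.dvalue f θ n (t + 1) s' _ (v, M.dnextPair θ t s z.1 s' _) =
      M.p s (M.polW s z.1) s' * M.dvalue f θ n (t + 1) s' _ (v, M.dnext θ t s z.1 z.2 s' v)
    rw [dnext_apply]
    rfl

theorem norm_dvalue_comp_inr_le (hM : M.Regular Θ) (hL : M.DerivBound Θ L)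
    (hf : M.IsReward f R K) (hθ : θ ∈ Θ) (i t : ℕ) (s : S) {g : Vec q} (hg : g ∈ M.G) :
    ‖(M.dvalue f θ i t s g).comp (ContinuousLinearMap.inr ℝ _ _)‖ ≤
      (i + 1) * ((K + R * L * L) * L ^ M.k) := by
  have h := hM.norm_dvalue_le hL hθ hf i t s hg
  refine ContinuousLinearMap.opNorm_le_bound _ ((norm_nonneg _).trans h) fun v => ?_
  refine (ContinuousLinearMap.le_of_opNorm_le _ h _).trans_eq ?_
  simp

theorem norm_manager_le (hM : M.Regular Θ) (hL : M.DerivBound Θ L)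
    (hf : M.IsReward f R K) (hθ : θ ∈ Θ) (i t : ℕ) (s : S) {g : Vec q} (hg : g ∈ M.G) :
    ‖((M.dvalue f θ i t s g).comp (ContinuousLinearMap.inr ℝ _ _)).comp (M.dpolM θ s)‖ ≤
      (i + 1) * ((K + R * L * L) * L ^ M.k) * L := by
  have h := hM.norm_dvalue_comp_inr_le hL hf hθ i t s hg
  exact (ContinuousLinearMap.opNorm_comp_le _ _).trans (mul_le_mul h (hL.polM_le θ hθ s)
    (norm_nonneg _) ((norm_nonneg _).trans h))

theorem stronglyMeasurable_manager (hM : M.Regular Θ) (hf : M.IsReward f R K)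
    (hθ : θ ∈ Θ) (i t : ℕ) : StronglyMeasurable fun w : S × Vec q =>
      ((M.dvalue f θ i t w.1 w.2).comp (ContinuousLinearMap.inr ℝ _ _)).comp
        (M.dpolM θ w.1) := by
  have h : Continuous fun w : (Vec d × Vec q →L[ℝ] ℝ) × (Vec d →L[ℝ] Vec q) =>
      (w.1.comp (ContinuousLinearMap.inr ℝ (Vec d) (Vec q))).comp w.2 :=
    (continuous_fst.clm_comp_const _).clm_comp continuous_snd
  exact h.comp_stronglyMeasurable ((hM.stronglyMeasurable_dvalue hθ hf i t).prodMk
    ((hM.measurable_dpolM hθ).comp measurable_fst).stronglyMeasurable)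

theorem goal_mul_k (x : ℕ → S) (t : ℕ) : M.goal θ x (M.k * t) = M.polM θ (x (M.k * t)) := by
  cases h : M.k * t with
  | zero => rfl
  | succ n =>
    rw [goal, goalFrom, nextGoal, if_pos]
    rw [zero_add, ← h, Nat.mul_mod_right]

/-- The policy gradient for a reward that does not depend on the goal, as a sum of the effects of
the manager's choices. -/
theorem dexpect_eq_sum_manager (hM : M.Regular Θ) (hL : M.DerivBound Θ L)
    (hf : M.IsReward f R K) (hf0 : ∀ s g, fderivOn M.G (f s) g = 0) (hθ : θ ∈ Θ) (n : ℕ) :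
    M.dexpect f (M.k * n) θ = ∑ j ∈ Finset.range (n + 1), M.expect θ (M.k * j) fun x =>
      ((M.dvalue f θ (M.k * (n - j)) (M.k * j) (x (M.k * j)) (M.polM θ (x (M.k * j)))).comp
        (ContinuousLinearMap.inr ℝ _ _)).comp (M.dpolM θ (x (M.k * j))) := by
  have hJ := hM.isMarkov_goalChain hθ
  -- The source is the effect of the manager's choice at time t, present only when the manager
  -- decides.
  set src : ℕ → ℕ → S → Vec q → (Vec d →L[ℝ] ℝ) := fun i t s g => if t % M.k = 0 then
    ((M.dvalue f θ i t s g).comp (ContinuousLinearMap.inr ℝ _ _)).comp (M.dpolM θ s) else 0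
    with hsrc_def
  have hsrc : ∀ i t, StronglyMeasurable fun w : S × Vec q => src i t w.1 w.2 := by
    intro i t
    simp only [hsrc_def]
    split_ifs
    · exact hM.stronglyMeasurable_manager hf hθ i t
    · exact stronglyMeasurable_const
  have hB : ∀ i t s, ∀ g ∈ M.G, ‖src i t s g‖ ≤
      ((i : ℝ) + 1) * ((K + R * L * L) * L ^ M.k) * L := by
    intro i t s g hg
    have h := hM.norm_manager_le hL hf hθ i t s hg
    simp only [hsrc_def]
    split_ifs
    · exact h
    · rw [norm_zero]
      exact (norm_nonneg _).trans h
  -- The unknown is the partial derivative in θ plus the effect of the present decision. As the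
  -- manager decides at time 0, it equals there the full derivative under the integral of `dexpect`.
  have hY := hJ.eq_sum_val (Y := fun n t s g =>
    (M.dvalue f θ n t s g).comp (ContinuousLinearMap.inl ℝ _ _) + src n t s g) (src := src)
    hsrc (fun i t => ⟨_, fun s z hz => hB i t s z hz⟩) ?_ ?_ (M.k * n) 0
  · have hz : Measurable fun s => (s, M.polM θ s) := measurable_id.prodMk (hM.polM_meas θ hθ)
    have h1 : ∀ s, M.ρ₀ s • (M.dvalue f θ (M.k * n) 0 s (M.polM θ s)).comp
        ((ContinuousLinearMap.id ℝ _).prod (M.dpolM θ s)) =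
        ∑ j ∈ Finset.range (M.k * n + 1), M.ρ₀ s • (M.goalChain θ).val
          (src (M.k * n - j) j) j 0 s (M.polM θ s) := fun s => by
      rw [← Finset.smul_sum]
      have := hY s _ (hM.polM_mem θ hθ s)
      simp only [zero_add] at this
      rw [← this]
      congr 1
      simp only [hsrc_def, Nat.zero_mod, if_true]
      ext v
      simp only [ContinuousLinearMap.comp_apply, add_apply, ← map_add]
      congr 1
      simp
    have h2 : M.dexpect f (M.k * n) θ = ∑ j ∈ Finset.range (M.k * n + 1),
        M.expect θ j fun x => src (M.k * n - j) j (x j) (M.goal θ x j) := by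
      unfold dexpect
      simp only [h1]
      rw [integral_finsetSum]
      · refine Finset.sum_congr rfl fun j _ => ?_
        exact (hM.expect_eq hθ (hsrc (M.k * n - j) j)
          (fun s g hg => hB (M.k * n - j) j s g hg) j).symm
      · intro j _
        refine hM.integrable_ρ₀.smul_bdd
          (((M.k * n - j : ℕ) + 1) * ((K + R * L * L) * L ^ M.k) * L) ?_ (ae_of_all _ fun s => ?_)
        · exact ((hJ.stronglyMeasurable_val (hsrc (M.k * n - j) j) j 0).comp_measurable
            hz).aestronglyMeasurable
        · exact hJ.norm_val_le (t := 0) (fun s g hg => hB (M.k * n - j) j s g hg) s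
            (hM.polM_mem θ hθ s)
    have hinj : Set.InjOn (fun j => M.k * j) (Finset.range (n + 1)) := fun a _ b _ h =>
      Nat.eq_of_mul_eq_mul_left hM.k_pos h
    rw [h2, ← Finset.sum_subset (s₁ := (Finset.range (n + 1)).image fun j => M.k * j),
      Finset.sum_image hinj]
    · refine Finset.sum_congr rfl fun j _ => ?_
      simp only [hsrc_def, Nat.mul_mod_right, if_true, goal_mul_k, Nat.mul_sub]
    · intro j hj
      obtain ⟨i, hi, rfl⟩ := Finset.mem_image.1 hj
      rw [Finset.mem_range] at hi ⊢
      exact Nat.lt_succ_of_le (Nat.mul_le_mul_left _ (Nat.le_of_lt_succ hi))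
    · intro j hj hj'
      -- Times that are not multiples of k carry no manager decision and contribute nothing.
      have : ¬ j % M.k = 0 := fun h => hj' (by
        obtain ⟨i, rfl⟩ := Nat.dvd_of_mod_eq_zero h
        refine Finset.mem_image_of_mem _ ?_
        rw [Finset.mem_range] at hj ⊢
        exact Nat.lt_succ_of_le (Nat.le_of_mul_le_mul_left (Nat.le_of_lt_succ hj) hM.k_pos))
      simp [hsrc_def, this, expect]
  · intro t s g _
    have : M.dvalue f θ 0 t s g = 0 := by
      change (fderivOn M.G (f s) g).comp _ = 0
      rw [hf0, ContinuousLinearMap.zero_comp]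
    simp only [this, ContinuousLinearMap.zero_comp, zero_add]
  · intro n t s g hg
    have hi := hM.integrable_transport_dvalue hL hθ hf s hg (n := n) (t := t)
      fun s' g' hg' => hM.norm_dvalue_le hL hθ hf n (t + 1) s' hg'
    rw [add_comm]
    congr 1
    -- Immediate effects factor through the goal, hence vanish in pure parameter directions.
    have h0 : ∀ T : Vec q →L[ℝ] ℝ, (T.comp (ContinuousLinearMap.snd ℝ (Vec d) (Vec q))).comp
        (ContinuousLinearMap.inl ℝ _ _) = 0 := fun T => by ext v; simp
    rw [dvalue, ContinuousLinearMap.add_comp, h0, zero_add,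
      ← (integral_clm_comp hi (ContinuousLinearMap.inl ℝ _ _)).2]
    refine integral_congr_ae (ae_of_all _ fun s' => ?_)
    ext v
    change M.p s (M.polW s g) s' * M.dvalue f θ n (t + 1) s' (M.nextGoal θ t s g s')
        (v, M.dnextPair θ t s g s' (v, 0)) = M.p s (M.polW s g) s' *
      (M.dvalue f θ n (t + 1) s' (M.nextGoal θ t s g s') (v, 0) +
        src n (t + 1) s' (M.nextGoal θ t s g s') v)
    congr 1
    simp only [hsrc_def, dnextPair]
    -- At a manager time the transported vector is (v, ∇π_m v) = (v, 0) + (0, ∇π_m v), and the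
    -- second part is the new source; otherwise it is (v, 0).
    split_ifs
    · simp only [ContinuousLinearMap.comp_apply, ContinuousLinearMap.inr_apply, ← map_add]
      simp
    · simp

theorem nextGoal_congr {t t' : ℕ} (h : t % M.k = t' % M.k) (s : S) (g : Vec q) (s' : S) :
    M.nextGoal θ t s g s' = M.nextGoal θ t' s g s' := by
  rw [nextGoal, nextGoal, Nat.add_mod, h, ← Nat.add_mod]

/-- Time enters only through the phase t mod k. This allows `Qm`, which is defined from time 0, to
be used at every time k * j. -/
theorem value_congr (n : ℕ) : ∀ {t t' : ℕ} (_ : t % M.k = t' % M.k) (s : S) (g : Vec q),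
    M.value f θ n t s g = M.value f θ n t' s g := by
  induction n with
  | zero => exact fun _ _ _ => rfl
  | succ n ih =>
    intro t t' h s g
    have h' : (t + 1) % M.k = (t' + 1) % M.k := by rw [Nat.add_mod, h, ← Nat.add_mod]
    rw [value_succ, value_succ]
    simp only [nextGoal_congr h, ih h']

theorem hasFDerivAt_value_goal (hM : M.Regular Θ) (hL : M.DerivBound Θ L) (hf : M.IsReward f R K)
    (hθ : θ ∈ Θ) (n t : ℕ) (s : S) {g : Vec q} (hg : g ∈ M.G) :
    HasFDerivAt (M.value f θ n t s)
      ((M.dvalue f θ n t s g).comp (ContinuousLinearMap.inr ℝ _ _)) g :=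
  (hM.hasFDerivAt_value hL hf n t θ hθ s g hg).comp g (hasFDerivAt_prodMk_right θ g)

end Regular

end HRLModel

/-! ### From functionals to gradients, and summation over time -/

namespace HRLModel

/-- The vector that represents a continuous linear functional. -/
noncomputable def riesz {n : ℕ} : (Vec n →L[ℝ] ℝ) →L[ℝ] Vec n :=
  LinearMap.mkContinuous
    { toFun := fun T => (InnerProductSpace.toDual ℝ (Vec n)).symm T
      map_add' := fun _ _ => map_add _ _ _
      map_smul' := fun c T => by simp } 1 fun T => by simp

theorem inner_riesz {n : ℕ} (T : Vec n →L[ℝ] ℝ) (v : Vec n) : inner ℝ (riesz T) v = T v :=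
  InnerProductSpace.toDual_symm_apply

theorem adjoint_riesz {n l : ℕ} (D : Vec n →L[ℝ] Vec l) (T : Vec l →L[ℝ] ℝ) :
    ContinuousLinearMap.adjoint D (riesz T) = riesz (T.comp D) :=
  ext_inner_right ℝ fun v => by
    rw [ContinuousLinearMap.adjoint_inner_left, inner_riesz, inner_riesz]
    rfl

theorem gradient_eq_riesz {n : ℕ} {f : Vec n → ℝ} {T : Vec n →L[ℝ] ℝ} {x : Vec n}
    (h : HasFDerivAt f T x) : gradient f x = riesz T := by
  rw [gradient, h.fderiv]
  rfl

theorem hasGradientAt_riesz {n : ℕ} {f : Vec n → ℝ} {T : Vec n →L[ℝ] ℝ} {x : Vec n}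
    (h : HasFDerivAt f T x) : HasGradientAt f (riesz T) x :=
  h.hasGradientAt

variable {S V W : Type*} [MeasurableSpace S] {m q d : ℕ}
  [NormedAddCommGroup V] [NormedSpace ℝ V] [NormedAddCommGroup W] [NormedSpace ℝ W]
  {M : HRLModel S m q d} {Θ : Set (Vec d)} {θ : Vec d} {N : ℕ∞} {L R K C : ℝ} {f : S → Vec q → ℝ}

theorem map_tsum_discounted (T : V →L[ℝ] W) {u : ℕ → V} (h : Summable (M.discounted N u)) :
    T (∑' n, M.discounted N u n) = ∑' n, M.discounted N (fun n => T (u n)) n := by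
  rw [T.map_tsum h]
  simp only [map_discounted]

theorem tsum_discounted_comp {n l : ℕ} {u : ℕ → Vec l →L[ℝ] ℝ} (h : Summable (M.discounted N u))
    (D : Vec n →L[ℝ] Vec l) : (∑' i, M.discounted N u i).comp D =
      ∑' i, M.discounted N (fun i => (u i).comp D) i :=
  map_tsum_discounted ((ContinuousLinearMap.compL ℝ (Vec n) (Vec l) ℝ).flip D) h

namespace Regular

theorem expectIntegrable_tsum_discounted [CompleteSpace V] (hM : M.Regular Θ) (hθ : θ ∈ Θ)
    (hN : M.γ < 1 ∨ N ≠ ⊤) {n : ℕ} {F : ℕ → (ℕ → S) → V}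
    (hF : ∀ i, M.ExpectIntegrable θ n (F i)) (hC : ∀ (i : ℕ) x, ‖F i x‖ ≤ C * ((i : ℝ) + 1)) :
    M.ExpectIntegrable θ n (fun x => ∑' i, M.discounted N (fun i => F i x) i) := by
  have hm : ∀ i, AEStronglyMeasurable (fun x : Fin (n + 1) → S =>
      M.discounted N (fun i => M.trajDensity θ x • F i (extend x)) i)
      (Measure.pi fun _ => M.vol) := fun i => by
    by_cases h : (i : ℕ∞) ≤ N
    · simp only [discounted_of_le h]
      exact (hF i).1.const_smul _
    · simp only [discounted_of_not_le h]
      exact aestronglyMeasurable_const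
  have heq : (fun x : Fin (n + 1) → S =>
      M.trajDensity θ x • ∑' i, M.discounted N (fun i => F i (extend x)) i) =
      fun x => ∑' i, M.discounted N (fun i => M.trajDensity θ x • F i (extend x)) i := by
    funext x
    simp only [← smul_discounted]
    exact (tsum_const_smul'' _).symm
  refine ((hM.integral_trajDensity hθ n).1.mul_const
    (∑' n, M.discounted N (fun n => C * ((n : ℝ) + 1)) n)).mono' ?_ (ae_of_all _ fun x => ?_)
  · rw [heq]
    -- The series of strongly measurable representatives agrees with the given one outside a
    -- countable union of null sets.
    refine ⟨fun x => ∑' i, (hm i).mk _ x,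
      StronglyMeasurable.tsum fun i => (hm i).stronglyMeasurable_mk, ?_⟩
    filter_upwards [ae_all_iff.2 fun i => (hm i).ae_eq_mk] with x hx using tsum_congr hx
  · rw [norm_smul, Real.norm_of_nonneg (hM.trajDensity_nonneg hθ x)]
    exact mul_le_mul_of_nonneg_left (norm_tsum_discounted_le hM.γ_pos.le hN fun i => hC i _)
      (hM.trajDensity_nonneg hθ x)

theorem expect_riesz_tsum_discounted (hM : M.Regular Θ) (hθ : θ ∈ Θ)
    (hN : M.γ < 1 ∨ N ≠ ⊤) {n : ℕ} {F : ℕ → (ℕ → S) → (Vec d →L[ℝ] ℝ)}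
    (hF : ∀ i, M.ExpectIntegrable θ n (F i)) (hC : ∀ (i : ℕ) x, ‖F i x‖ ≤ C * ((i : ℝ) + 1)) :
    M.ExpectIntegrable θ n (fun x => riesz (∑' i, M.discounted N (fun i => F i x) i)) ∧
    M.expect θ n (fun x => riesz (∑' i, M.discounted N (fun i => F i x) i)) =
      riesz (∑' i, M.discounted N (fun i => M.expect θ n (F i)) i) := by
  have h := expect_clm_comp riesz (hM.expectIntegrable_tsum_discounted hθ hN hF hC)
  exact ⟨h.1, by rw [h.2, hM.expect_tsum_discounted hθ hN hF hC]⟩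

/-- A return whose terms have derivatives that are sums over past times is differentiable, and its
gradient is a series over the times of the causes. -/
theorem hasGradientAt_tsum_discounted (hM : M.Regular Θ) (hθ : θ ∈ Θ) (hN : M.γ < 1 ∨ N ≠ ⊤)
    {C' R' : ℝ} {J : ℕ → Vec d → ℝ} {J' : ℕ → Vec d → Vec d →L[ℝ] ℝ}
    (hJ : ∀ i, ∀ θ' ∈ Θ, HasFDerivAt (J i) (J' i θ') θ') (hJR : ∀ i, ‖J i θ‖ ≤ R')
    (hJ' : ∀ i, ∀ θ' ∈ Θ, ‖J' i θ'‖ ≤ C' * ((i : ℝ) + 1)) {τ : ℕ → ℕ}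
    {F : ℕ → ℕ → (ℕ → S) → (Vec d →L[ℝ] ℝ)} (hF : ∀ i j, M.ExpectIntegrable θ (τ j) (F i j))
    (hC : ∀ (i : ℕ) (j : ℕ) x, ‖F i j x‖ ≤ C * ((i : ℝ) + 1))
    (hsum : ∀ n, J' n θ = ∑ j ∈ Finset.range (n + 1), M.expect θ (τ j) (F (n - j) j))
    {D : ℕ → (ℕ → S) → Vec d}
    (hD : ∀ j x, D j x = riesz (∑' i, M.discounted (N - j) (fun i => F i j x) i)) :
    (∀ j, M.ExpectIntegrable θ (τ j) (D j)) ∧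
    Summable (M.discounted N fun j => M.expect θ (τ j) (D j)) ∧
    HasGradientAt (fun θ' => ∑' n, M.discounted N (fun n => J n θ') n)
      (∑' j, M.discounted N (fun j => M.expect θ (τ j) (D j)) j) θ := by
  have hγ := hM.γ_pos.le
  have hDF : ∀ j, D j = fun x => riesz (∑' i, M.discounted (N - j) (fun i => F i j x) i) :=
    fun j => funext (hD j)
  have hE := fun j : ℕ => hM.expect_riesz_tsum_discounted hθ (ne_top_sub hN (j : ℕ∞))
    (fun i => hF i j) (fun i => hC i j)
  -- The time n of the reward is split into the time j of the cause and the delay n - j.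
  have hanti := tsum_discounted_antidiagonal (M := M) (N := N) hγ hN
    (T := fun i j => M.expect θ (τ j) (F i j)) fun i j => hM.norm_expect_le hθ (hC i j)
  have hEj : (M.discounted N fun j => M.expect θ (τ j) (D j)) = fun j => riesz (M.discounted N
      (fun j => ∑' i, M.discounted (N - j) (fun i => M.expect θ (τ j) (F i j)) i) j) := by
    funext j
    rw [map_discounted]
    simp only [hDF, (hE _).2]
  refine ⟨fun j => ?_, ?_, ?_⟩
  · rw [hDF]
    exact (hE j).1
  · rw [hEj]
    exact riesz.summable hanti.1
  · have h := hasFDerivAt_tsum_discounted hγ hN hM.isOpen_param hJ hJ' hθ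
      (summable_discounted_of_norm_le hγ hN hJR)
    simp only [hsum] at h
    rw [hanti.2] at h
    simp only [hEj]
    rw [← riesz.map_tsum hanti.1]
    exact hasGradientAt_riesz h

/-! ### The manager's return -/

section Manager

theorem exists_isReward_rewM (hM : M.Regular Θ) :
    ∃ R, M.IsReward (fun s _ => M.rewM s) R 0 := by
  obtain ⟨R, hR⟩ := hM.rewM_bdd
  refine ⟨|R|, hM.rewM_meas.comp measurable_fst, fun s _ _ => (hR s).trans (le_abs_self R),
    fun s g _ => differentiableAt_const _, fun s g hg => ?_, abs_nonneg R, le_rfl⟩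
  rw [fderivOn_of_mem hg, fderiv_fun_const]
  simp

theorem hasFDerivAt_Qm (hM : M.Regular Θ) (hL : M.DerivBound Θ L)
    (hf : M.IsReward (fun s _ => M.rewM s) R 0) (hθ : θ ∈ Θ) (hN : M.γ < 1 ∨ N ≠ ⊤) (s : S)
    {g : Vec q} (hg : g ∈ M.G) :
    HasFDerivAt (M.Qm θ N s) (∑' i, M.discounted N
      (fun i => (M.dvalue (fun s _ => M.rewM s) θ (M.k * i) 0 s g).comp
        (ContinuousLinearMap.inr ℝ _ _)) i) g := by
  have h := hasFDerivAt_tsum_discounted (M := M) (N := N)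
    (C := M.k * ((0 + R * L * L) * L ^ M.k)) hM.γ_pos.le hN hM.isOpen_G
    (fun i g hg => hM.hasFDerivAt_value_goal hL hf hθ (M.k * i) 0 s hg) (fun i g hg => ?_) hg
    (summable_discounted_of_norm_le hM.γ_pos.le hN fun i =>
      hM.abs_value_le hθ hf (M.k * i) 0 s hg)
  -- The series of conditional expectations is identified with chain values only for admissible
  -- goals, which fill a neighbourhood because `G` is open.
  · refine h.congr_of_eventuallyEq ?_
    filter_upwards [hM.isOpen_G.mem_nhds hg] with a ha
    unfold Qm
    refine tsum_congr fun n => congrFun (discounted_congr fun n _ => ?_) n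
    exact hM.condExpect_eq_val hθ hf.meas hf.le 0 s ha (M.k * n)
  · refine (hM.norm_dvalue_comp_inr_le hL hf hθ (M.k * i) 0 s hg).trans ?_
    -- Growth linear in k * i is linear in i, since k * i + 1 ≤ k * (i + 1) for k ≥ 1.
    have hk : (1 : ℝ) ≤ M.k := by exact_mod_cast hM.k_pos
    have hD : 0 ≤ (0 + R * L * L) * L ^ M.k := by
      have := hf.R_nonneg
      have := zero_le_one.trans hL.one_le
      positivity
    push_cast
    nlinarith

theorem managerGrad_eq (hM : M.Regular Θ) (hL : M.DerivBound Θ L)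
    (hf : M.IsReward (fun s _ => M.rewM s) R 0) (hθ : θ ∈ Θ) (hN : M.γ < 1 ∨ N ≠ ⊤) (j : ℕ)
    (s : S) : M.managerGrad θ N s = riesz (∑' i, M.discounted N
      (fun i => ((M.dvalue (fun s _ => M.rewM s) θ (M.k * i) (M.k * j) s (M.polM θ s)).comp
        (ContinuousLinearMap.inr ℝ _ _)).comp (M.dpolM θ s)) i) := by
  have hg := hM.polM_mem θ hθ s
  -- The times 0 and k * j have the same phase, so the values coincide as functions of the goal;
  -- uniqueness of derivatives identifies their partial derivatives.
  have hshift : ∀ i, (M.dvalue (fun s _ => M.rewM s) θ (M.k * i) 0 s (M.polM θ s)).comp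
      (ContinuousLinearMap.inr ℝ _ _) =
      (M.dvalue (fun s _ => M.rewM s) θ (M.k * i) (M.k * j) s (M.polM θ s)).comp
      (ContinuousLinearMap.inr ℝ _ _) := fun i => by
    refine (hM.hasFDerivAt_value_goal hL hf hθ (M.k * i) 0 s hg).unique ?_
    refine (hM.hasFDerivAt_value_goal hL hf hθ (M.k * i) (M.k * j) s hg).congr_of_eventuallyEq
      (Eventually.of_forall fun g => ?_)
    exact value_congr _ (by simp) s g
  have hs : Summable (M.discounted N fun i => (M.dvalue (fun s _ => M.rewM s) θ (M.k * i) (M.k * j)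
      s (M.polM θ s)).comp (ContinuousLinearMap.inr ℝ (Vec d) (Vec q))) := by
    refine summable_discounted (C := M.k * ((0 + R * L * L) * L ^ M.k)) hM.γ_pos.le hN fun i => ?_
    refine (hM.norm_dvalue_comp_inr_le hL hf hθ (M.k * i) (M.k * j) s hg).trans ?_
    have hk : (1 : ℝ) ≤ M.k := by exact_mod_cast hM.k_pos
    have hD : 0 ≤ (0 + R * L * L) * L ^ M.k := by
      have := hf.R_nonneg
      have := zero_le_one.trans hL.one_le
      positivity
    push_cast
    nlinarith
  rw [managerGrad, gradient_eq_riesz (hM.hasFDerivAt_Qm hL hf hθ hN s hg), adjoint_riesz]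
  simp only [hshift]
  exact congrArg riesz (tsum_discounted_comp hs (M.dpolM θ s))

theorem manager_gradient (hM : M.Regular Θ) (hθ : θ ∈ Θ) (hN : M.γ < 1 ∨ N ≠ ⊤) :
    (∀ t : ℕ, M.ExpectIntegrable θ (M.k * t) fun x =>
      M.managerGrad θ (N - t) (x (M.k * t))) ∧
    Summable (M.discounted N fun t =>
      M.expect θ (M.k * t) fun x => M.managerGrad θ (N - t) (x (M.k * t))) ∧
    HasGradientAt (M.Jm N) (∑' t, M.discounted N (fun t =>
      M.expect θ (M.k * t) fun x => M.managerGrad θ (N - t) (x (M.k * t))) t) θ := by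
  obtain ⟨L, hL⟩ := hM.exists_derivBound
  obtain ⟨R, hf⟩ := hM.exists_isReward_rewM
  have hf0 : ∀ (s : S) (g : Vec q), fderivOn M.G (fun _ => M.rewM s) g = 0 := fun s g => by
    unfold fderivOn
    split_ifs
    · rw [fderiv_fun_const]
      rfl
    · rfl
  have hk : (1 : ℝ) ≤ M.k := by exact_mod_cast hM.k_pos
  have hD : 0 ≤ (0 + R * L * L) * L ^ M.k * L := by
    have := hf.R_nonneg
    have := zero_le_one.trans hL.one_le
    positivity
  have hki : ∀ i : ℕ, (((M.k * i : ℕ) : ℝ) + 1) * ((0 + R * L * L) * L ^ M.k) * L ≤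
      M.k * ((0 + R * L * L) * L ^ M.k * L) * ((i : ℝ) + 1) := fun i => by
    push_cast
    nlinarith
  refine hM.hasGradientAt_tsum_discounted hθ hN
    (J := fun n θ' => M.expect θ' (M.k * n) fun x => M.rewM (x (M.k * n)))
    (J' := fun n θ' => M.dexpect (fun s _ => M.rewM s) (M.k * n) θ') (τ := fun j => M.k * j)
    (F := fun i j x => ((M.dvalue (fun s _ => M.rewM s) θ (M.k * i) (M.k * j) (x (M.k * j))
      (M.polM θ (x (M.k * j)))).comp (ContinuousLinearMap.inr ℝ _ _)).comp
        (M.dpolM θ (x (M.k * j))))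
    (fun i θ' hθ' => hM.hasFDerivAt_expect hL hf hθ' (M.k * i))
    (fun i => hM.norm_expect_le hθ fun x => hf.le _ _ (hM.polM_mem θ hθ (x 0)))
    (fun i θ' hθ' => (hM.norm_dexpect_le hL hf hθ' (M.k * i)).trans (hki i))
    (fun i j => ?_)
    (fun i j x => (hM.norm_manager_le hL hf hθ (M.k * i) (M.k * j) (x (M.k * j))
      (hM.polM_mem θ hθ _)).trans (hki i))
    (fun n => hM.dexpect_eq_sum_manager hL hf hf0 hθ n)
    (fun j x => hM.managerGrad_eq hL hf hθ (ne_top_sub hN j) j (x (M.k * j)))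
  have := hM.expectIntegrable hθ (hM.stronglyMeasurable_manager hf hθ (M.k * i) (M.k * j))
    (fun s g hg => hM.norm_manager_le hL hf hθ (M.k * i) (M.k * j) s hg) (M.k * j)
  simpa only [goal_mul_k] using this

end Manager

/-! ### The worker's return -/

section Worker

/-- The worker's reward as a function of the state and the goal. -/
noncomputable def _root_.HRLModel.goalReward (M : HRLModel S m q d) (s : S) (g : Vec q) : ℝ :=
  M.rewW s g (M.polW s g)

theorem hasFDerivAt_goalReward (hM : M.Regular Θ) (s : S) {g : Vec q} (hg : g ∈ M.G) :
    HasFDerivAt (M.goalReward s)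
      ((fderiv ℝ (fun z : Vec q × Vec m => M.rewW s z.1 z.2) (g, M.polW s g)).comp
        ((ContinuousLinearMap.id ℝ _).prod (M.dpolW s g))) g :=
  HasFDerivAt.comp (f := fun g' => (g', M.polW s g'))
    (g := fun z : Vec q × Vec m => M.rewW s z.1 z.2) g
    (hM.rewW_diff s g hg _ (hM.polW_mem s g hg)).hasFDerivAt
    ((hasFDerivAt_id g).prodMk (hM.hasFDerivAt_polW s hg))

theorem exists_isReward_goalReward (hM : M.Regular Θ) : ∃ R K, M.IsReward M.goalReward R K := by
  obtain ⟨L, hL⟩ := hM.exists_derivBound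
  have hL0 : 0 ≤ L := zero_le_one.trans hL.one_le
  obtain ⟨R, hR⟩ := hM.rewW_bdd
  obtain ⟨K, hK⟩ := hM.rewW_fderiv_bdd
  refine ⟨|R|, |K| * L, ?_, fun s g hg => (hR s g hg _ (hM.polW_mem s g hg)).trans (le_abs_self R),
    fun s g hg => (hM.hasFDerivAt_goalReward s hg).differentiableAt, fun s g hg => ?_, abs_nonneg R,
    by positivity⟩
  · exact hM.rewW_meas.comp (measurable_fst.prodMk (measurable_snd.prodMk hM.polW_meas))
  · rw [fderivOn_of_mem hg, (hM.hasFDerivAt_goalReward s hg).fderiv]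
    refine (ContinuousLinearMap.opNorm_comp_le _ _).trans (mul_le_mul
      ((hK s g hg _ (hM.polW_mem s g hg)).trans (le_abs_self K)) ?_ (norm_nonneg _) (abs_nonneg K))
    refine ContinuousLinearMap.opNorm_le_bound _ hL0 fun v => max_le ?_ ?_
    · exact le_mul_of_one_le_left (norm_nonneg _) hL.one_le
    · exact ContinuousLinearMap.le_of_opNorm_le _ (hL.polW_le s g hg) v

theorem Vw_eq (hM : M.Regular Θ) (hf : M.IsReward M.goalReward R K) (hθ : θ ∈ Θ) (t : ℕ) (s : S)
    {g : Vec q} (hg : g ∈ M.G) :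
    M.Vw θ N t s g = ∑' n, M.discounted N (fun n => M.value M.goalReward θ n t s g) n :=
  tsum_congr fun n => congrFun (discounted_congr fun n _ =>
    hM.condExpect_eq_val hθ hf.meas hf.le t s hg n) n

/-- The derivative of `Q_w` with respect to the action. -/
noncomputable def _root_.HRLModel.dQw (M : HRLModel S m q d) (θ : Vec d) (N : ℕ∞) (t : ℕ)
    (s : S) (g : Vec q) (a : Vec m) : Vec m →L[ℝ] ℝ :=
  (fderiv ℝ (fun z : Vec q × Vec m => M.rewW s z.1 z.2) (g, a)).comp
      (ContinuousLinearMap.inr ℝ _ _) +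
    open Classical in
    if N = 0 then 0
    else M.γ • ∑' n, M.discounted (N - 1) (fun n => M.actDeriv s a
      (fun s' => M.value M.goalReward θ n (t + 1) s' (M.nextGoal θ t s g s'))) n

/-- The continuation value is a bounded function of the next state that does not involve the action
varied here, so only the density is differentiated. Uniform bounds on the values and the L¹ bound on
the density gradient then allow the series to be taken out of the integral. -/
theorem hasFDerivAt_Qw (hM : M.Regular Θ) (hL : M.DerivBound Θ L)
    (hf : M.IsReward M.goalReward R K) (hθ : θ ∈ Θ) (hN : M.γ < 1 ∨ N ≠ ⊤) (t : ℕ) (s : S)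
    {g : Vec q} (hg : g ∈ M.G) {a : Vec m} (ha : a ∈ M.A) :
    HasFDerivAt (M.Qw θ N t s g) (M.dQw θ N t s g a) a := by
  have hγ := hM.γ_pos.le
  refine HasFDerivAt.add ?_ ?_
  · exact (hM.rewW_diff s g hg a ha).hasFDerivAt.comp a (hasFDerivAt_prodMk_right g a)
  · split_ifs with h0
    · exact hasFDerivAt_const _ _
    refine HasFDerivAt.const_mul ?_ _
    have hN1 := ne_top_sub hN 1
    have hval : ∀ n s', |M.value M.goalReward θ n (t + 1) s' (M.nextGoal θ t s g s')| ≤ R :=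
      fun n s' => hM.abs_value_le hθ hf n (t + 1) s' (hM.nextGoal_mem hθ t s hg s')
    have hlin : ∀ {B : ℝ} (_ : 0 ≤ B) (n : ℕ), B ≤ B * ((n : ℝ) + 1) := fun hB n =>
      le_mul_of_one_le_right hB (by simp)
    have hV : ∀ s', M.Vw θ (N - 1) (t + 1) s' (M.nextGoal θ t s g s') =
        ∑' n, M.discounted (N - 1)
          (fun n => M.value M.goalReward θ n (t + 1) s' (M.nextGoal θ t s g s')) n := fun s' =>
      hM.Vw_eq hf hθ (t + 1) s' (hM.nextGoal_mem hθ t s hg s')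
    simp only [hV]
    have hmeas : Measurable fun s' => ∑' n, M.discounted (N - 1)
        (fun n => M.value M.goalReward θ n (t + 1) s' (M.nextGoal θ t s g s')) n := by
      refine Measurable.tsum fun n => ?_
      by_cases h : (n : ℕ∞) ≤ N - 1
      · simp only [discounted_of_le h, smul_eq_mul]
        exact (hM.measurable_next_value hθ hf n t s g).const_mul _
      · simp only [discounted_of_not_le h]
        exact measurable_const
    have hder := hM.hasFDerivAt_integral_p s ha hmeas.aestronglyMeasurable fun s' =>
      norm_tsum_discounted_le (M := M) (N := N - 1) (C := R)
        (u := fun n => M.value M.goalReward θ n (t + 1) s' (M.nextGoal θ t s g s')) hγ hN1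
        (fun n => (hval n s').trans (hlin hf.R_nonneg n))
    refine hder.congr_fderiv ?_
    have hsum := hasSum_integral_discounted (M := M) (N := N - 1) (μ := M.vol) (C := R * L) hγ hN1
      (u := fun n s' => M.value M.goalReward θ n (t + 1) s' (M.nextGoal θ t s g s') •
        M.dp s a s')
      (fun n => hM.integrable_smul_dp s ha
        (hM.measurable_next_value hθ hf n t s g).aestronglyMeasurable (hval n)) (fun n => ?_)
    · refine Eq.trans ?_ hsum.tsum_eq.symm
      refine integral_congr_ae (ae_of_all _ fun s' => ?_)
      have hs : Summable (M.discounted (N - 1) fun n =>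
          M.value M.goalReward θ n (t + 1) s' (M.nextGoal θ t s g s')) :=
        summable_discounted_of_norm_le hγ hN1 fun n => hval n s'
      exact map_tsum_discounted ((ContinuousLinearMap.id ℝ ℝ).smulRight (M.dp s a s')) hs
    · refine le_trans ?_ (hlin (mul_nonneg hf.R_nonneg (zero_le_one.trans hL.one_le)) n)
      refine (integral_mono_of_nonneg (ae_of_all _ fun s' => norm_nonneg _)
        ((hM.integrable_dp s ha).norm.const_mul R) (ae_of_all _ fun s' => ?_)).trans ?_
      · simp only [norm_smul]
        exact mul_le_mul_of_nonneg_right (hval n s') (norm_nonneg _)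
      · rw [integral_const_mul]
        exact mul_le_mul_of_nonneg_left (hL.p_le s a ha) hf.R_nonneg

/-- In the reward with frozen action only the direct dependence on the goal is differentiated, and
in the inner product only π_w(s, g), its gradient factor being frozen. The direct part and the
reward part of ∇_a Q_w add up to the total derivative of r_w(s, g, π_w(s, g)), the term with no
delay; the continuation part of Q_w supplies the terms with delay at least one. -/
theorem goalGrad_eq (hM : M.Regular Θ) (hL : M.DerivBound Θ L)
    (hf : M.IsReward M.goalReward R K) (hθ : θ ∈ Θ) (hN : M.γ < 1 ∨ N ≠ ⊤) (t : ℕ) (s : S)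
    {g : Vec q} (hg : g ∈ M.G) :
    M.goalGrad θ N t s g =
      riesz (∑' i, M.discounted N (fun i => M.immediateDeriv M.goalReward θ i t s g) i) := by
  have ha := hM.polW_mem s g hg
  have hγ := hM.γ_pos.le
  have hQ := hM.hasFDerivAt_Qw hL hf hθ hN t s hg ha
  have h1 : HasFDerivAt (fun g' => M.rewW s g' (M.polW s g))
      ((fderiv ℝ (fun z : Vec q × Vec m => M.rewW s z.1 z.2) (g, M.polW s g)).comp
        (ContinuousLinearMap.inl ℝ _ _)) g :=
    HasFDerivAt.comp (f := fun g' => (g', M.polW s g))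
      (g := fun z : Vec q × Vec m => M.rewW s z.1 z.2) g
      (hM.rewW_diff s g hg _ ha).hasFDerivAt (hasFDerivAt_prodMk_left g (M.polW s g))
  have h2 : HasFDerivAt (fun g' => inner ℝ (M.polW s g')
      (gradient (fun a => M.Qw θ N t s g a) (M.polW s g)))
      ((M.dQw θ N t s g (M.polW s g)).comp (M.dpolW s g)) g := by
    have : (fun g' => inner ℝ (M.polW s g')
        (gradient (fun a => M.Qw θ N t s g a) (M.polW s g))) =
        fun g' => M.dQw θ N t s g (M.polW s g) (M.polW s g') := by
      funext g'
      rw [gradient_eq_riesz hQ, real_inner_comm, inner_riesz]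
    rw [this]
    exact (M.dQw θ N t s g (M.polW s g)).hasFDerivAt.comp g (hM.hasFDerivAt_polW s hg)
  refine (gradient_eq_riesz (h1.add h2)).trans (congrArg riesz ?_)
  have himm : ∀ N : ℕ∞, M.γ < 1 ∨ N ≠ ⊤ →
      Summable (M.discounted N fun i => M.immediateDeriv M.goalReward θ i t s g) := fun N hN =>
    summable_discounted_of_norm_le hγ hN fun i => hM.norm_immediateDeriv_le hL hθ hf i t s hg
  -- The shift of the series by one step produces the factor γ and the horizon N - 1 of the
  -- continuation value, and nothing at all when N = 0.
  rw [tsum_discounted_eq_zero_add _ (himm N hN), dQw, ContinuousLinearMap.add_comp, ← add_assoc]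
  congr 1
  · rw [immediateDeriv, fderivOn_of_mem hg, (hM.hasFDerivAt_goalReward s hg).fderiv]
    ext v
    simp only [add_apply, ContinuousLinearMap.comp_apply, ← map_add]
    congr 1
    simp
  · split_ifs with h0
    · exact ContinuousLinearMap.zero_comp _
    · rw [ContinuousLinearMap.smul_comp]
      congr 1
      refine tsum_discounted_comp ?_ (M.dpolW s g)
      exact summable_discounted_of_norm_le hγ (ne_top_sub hN 1) fun n =>
        hM.norm_actDeriv_le hL s ha hf.R_nonneg fun s' =>
          hM.abs_value_le hθ hf n (t + 1) s' (hM.nextGoal_mem hθ t s hg s')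

theorem worker_gradient (hM : M.Regular Θ) (hθ : θ ∈ Θ) (hN : M.γ < 1 ∨ N ≠ ⊤) :
    (∀ t : ℕ, M.ExpectIntegrable θ t (M.workerGrad θ (N - t) t)) ∧
    Summable (M.discounted N fun t => M.expect θ t (M.workerGrad θ (N - t) t)) ∧
    HasGradientAt (M.Jw N) (∑' t, M.discounted N (fun t =>
      M.expect θ t (M.workerGrad θ (N - t) t)) t) θ := by
  obtain ⟨L, hL⟩ := hM.exists_derivBound
  obtain ⟨R, K, hf⟩ := hM.exists_isReward_goalReward
  -- Along every trajectory the actual Jacobian of the goal stays in the admissible set, which makes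
  -- the bounds on the terms uniform in time.
  have hdom : ∀ (x : ℕ → S) j, (M.goal θ x j, fderiv ℝ (fun θ' => M.goal θ' x j) θ) ∈
      (M.jacobianChain θ L).dom j := fun x j => by
    rw [← hM.path_jacobianChain_eq hθ x j]
    simpa using (hM.isMarkov_jacobianChain hL hθ).path_mem
      (hM.polM_mem_jacobianChain hL hθ (x 0)) x j
  have hB : 0 ≤ (K + R * L * L) * L ^ M.k := by
    have := hf.R_nonneg
    have := hf.L_nonneg
    have := zero_le_one.trans hL.one_le
    positivity
  have hD : ∀ (j : ℕ) (x : ℕ → S), M.workerGrad θ (N - j) j x = riesz (∑' i, M.discounted (N - j)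
      (fun i => (M.immediateDeriv M.goalReward θ i j (x j) (M.goal θ x j)).comp
        (fderiv ℝ (fun θ' => M.goal θ' x j) θ)) i) := by
    intro j x
    have hg := hM.goal_mem hθ x j
    rw [workerGrad, hM.goalGrad_eq hL hf hθ (ne_top_sub hN j) j (x j) hg, adjoint_riesz]
    refine congrArg riesz (tsum_discounted_comp ?_ (fderiv ℝ (fun θ' => M.goal θ' x j) θ))
    exact summable_discounted_of_norm_le hM.γ_pos.le (ne_top_sub hN j) fun i =>
      hM.norm_immediateDeriv_le hL hθ hf i j (x j) hg
  have hF : ∀ i j, M.ExpectIntegrable θ j fun x =>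
      (M.immediateDeriv M.goalReward θ i j (x j) (M.goal θ x j)).comp
        (fderiv ℝ (fun θ' => M.goal θ' x j) θ) := fun i j =>
    hM.expectIntegrable_jacobian hL hθ
      (F := fun s z => (M.immediateDeriv M.goalReward θ i j s z.1).comp z.2)
      (hM.stronglyMeasurable_immediateDeriv_comp hf hθ i j)
      fun s z hz => hM.norm_immediateDeriv_comp_le hL hf hθ i j s hz
  have hC : ∀ (i j : ℕ) x, ‖(M.immediateDeriv M.goalReward θ i j (x j) (M.goal θ x j)).comp
      (fderiv ℝ (fun θ' => M.goal θ' x j) θ)‖ ≤ (K + R * L * L) * L ^ M.k * ((i : ℝ) + 1) :=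
    fun i j x => (hM.norm_immediateDeriv_comp_le hL hf hθ i j (x j) (hdom x j)).trans
      (le_mul_of_one_le_right hB (by simp))
  exact hM.hasGradientAt_tsum_discounted hθ hN (C' := (K + R * L * L) * L ^ M.k * L)
    (J := fun n θ' => M.expect θ' n fun x => M.goalReward (x n) (M.goal θ' x n))
    (τ := fun j => j)
    (fun i θ' hθ' => hM.hasFDerivAt_expect hL hf hθ' i)
    (fun i => hM.norm_expect_le hθ fun x => hf.le _ _ (hM.goal_mem hθ x i))
    (fun i θ' hθ' => (hM.norm_dexpect_le hL hf hθ' i).trans_eq (by ring)) hF hC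
    (fun n => hM.dexpect_eq_sum_immediate hL hf hθ n) hD

end Worker

end Regular

end HRLModel

end

theorem theorem1 {S : Type*} [MeasurableSpace S] {m q d : ℕ} (M : HRLModel S m q d)
    (Θ : Set (EuclideanSpace ℝ (Fin d))) (hM : M.Regular Θ)
    -- horizons of the manager's and of the worker's return
    (Nm Nw : ℕ∞) (hN : M.γ < 1 ∨ (Nm ≠ ⊤ ∧ Nw ≠ ⊤))
    (lam : ℝ) (θ : EuclideanSpace ℝ (Fin d)) (hθ : θ ∈ Θ) :
    -- the two returns are well defined
    (∀ t, M.ExpectIntegrable θ (M.k * t) fun x => M.rewM (x (M.k * t))) ∧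
    Summable (M.discounted Nm fun t =>
      M.expect θ (M.k * t) fun x => M.rewM (x (M.k * t))) ∧
    (∀ t, M.ExpectIntegrable θ t (M.workerReward θ t)) ∧
    Summable (M.discounted Nw fun t => M.expect θ t (M.workerReward θ t)) ∧
    -- the derivatives in the formula exist
    (∀ t : ℕ, (t : ℕ∞) ≤ Nm → ∀ s, ∀ a ∈ M.G,
      DifferentiableAt ℝ (fun a' => M.Qm θ (Nm - t) s a') a) ∧
    (∀ t : ℕ, (t : ℕ∞) ≤ Nw → ∀ s, ∀ g ∈ M.G, ∀ a ∈ M.A,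
      DifferentiableAt ℝ (fun a' => M.Qw θ (Nw - t) t s g a') a) ∧
    (∀ (x : ℕ → S) (t : ℕ), DifferentiableAt ℝ (fun θ' => M.goal θ' x t) θ) ∧
    -- the expectations in the formula are well defined
    (∀ t : ℕ, (t : ℕ∞) ≤ Nm →
      M.ExpectIntegrable θ (M.k * t) fun x => M.managerGrad θ (Nm - t) (x (M.k * t))) ∧
    Summable (M.discounted Nm fun t =>
      M.expect θ (M.k * t) fun x => M.managerGrad θ (Nm - t) (x (M.k * t))) ∧
    (∀ t : ℕ, (t : ℕ∞) ≤ Nw → M.ExpectIntegrable θ t (M.workerGrad θ (Nw - t) t)) ∧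
    Summable (M.discounted Nw fun t => M.expect θ t (M.workerGrad θ (Nw - t) t)) ∧
    -- the cooperative gradient
    HasGradientAt (fun θ' => M.Jm Nm θ' + lam * M.Jw Nw θ')
      ((∑' t, M.discounted Nm (fun t =>
          M.expect θ (M.k * t) fun x => M.managerGrad θ (Nm - t) (x (M.k * t))) t) +
        lam • ∑' t, M.discounted Nw (fun t =>
          M.expect θ t (M.workerGrad θ (Nw - t) t)) t) θ := by
  obtain ⟨L, hL⟩ := hM.exists_derivBound
  obtain ⟨Rm, hfm⟩ := hM.exists_isReward_rewM
  obtain ⟨Rw, Kw, hfw⟩ := hM.exists_isReward_goalReward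
  have hγ := hM.γ_pos.le
  have hNm : M.γ < 1 ∨ Nm ≠ ⊤ := hN.imp id And.left
  have hNw : M.γ < 1 ∨ Nw ≠ ⊤ := hN.imp id And.right
  obtain ⟨hm1, hm2, hm3⟩ := hM.manager_gradient hθ hNm
  obtain ⟨hw1, hw2, hw3⟩ := hM.worker_gradient hθ hNw
  refine ⟨fun t => hM.expectIntegrable hθ (F := fun s _ => M.rewM s)
      hfm.meas.stronglyMeasurable hfm.le _,
    HRLModel.summable_discounted_of_norm_le hγ hNm fun t =>
      hM.norm_expect_le hθ fun x => hfm.le _ _ (hM.polM_mem θ hθ (x 0)),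
    fun t => hM.expectIntegrable hθ (F := M.goalReward)
      hfw.meas.stronglyMeasurable hfw.le t,
    HRLModel.summable_discounted_of_norm_le hγ hNw fun t =>
      hM.norm_expect_le hθ fun x => hfw.le _ _ (hM.goal_mem hθ x t),
    fun t _ s a ha => (hM.hasFDerivAt_Qm hL hfm hθ
      (HRLModel.ne_top_sub hNm t) s ha).differentiableAt,
    fun t _ s g hg a ha => (hM.hasFDerivAt_Qw hL hfw hθ
      (HRLModel.ne_top_sub hNw t) t s hg ha).differentiableAt,
    fun x t => (hM.hasFDerivAt_goal (L := L) hθ x t).differentiableAt,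
    fun t _ => hm1 t, hm2, fun t _ => hw1 t, hw2, ?_⟩
  have h := hm3.hasFDerivAt.add (hw3.hasFDerivAt.const_mul lam)
  rw [hasGradientAt_iff_hasFDerivAt, map_add, map_smul]
  exact h
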